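/- Let $m\ge 1$ be an integer and $0<a<1$. There is a unique real polynomial $P_m$ of degree at most $2m$ that best approximates $|x|$ uniformly on $[-1,-a]\cup[a,1]$; let $$L=\min_{\deg P\le 2m}\ \max_{a\le |x|\le 1}\bigl||x|-P(x)\bigr|$$ be the approximation error. Then there is a simple curve $\gamma:(0,\infty)\to\mathbb C$ inside the half-strip $$S=\{u+iv:\ 0<u<(m+1)\pi,\ v>0\},$$ starting at a point $iv_0$, $v_0>0$, of its left side (that is, $\gamma(y)\to iv_0$ as $y\to 0^+$) and running to infinity (that is, $\operatorname{Im}\gamma(y)\to+\infty$ as $y\to+\infty$), such that $$P_m(z)=z+L\cos\phi_m(z)\qquad(\operatorname{Re}z\ge0,\ \operatorname{Im}z\ge0),$$ where $\phi_m$ is a conformal map of the open first quadrant onto the region $G\subset S$ bounded on the left by $\gamma$, i.e. the connected component $G$ of $S\setminus\gamma((0,\infty))$ whose boundary consists of $\gamma((0,\infty))$, the segment $[0,iv_0]$, the segment $[0,(m+1)\pi]$ and the ray $\{(m+1)\pi+iv:\ v\ge 0\}$. The map $\phi_m$ extends continuously to the closed first quadrant and is normalized by $\phi_m(a)=0$,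 $\phi_m(1)=(m+1)\pi$ and $\phi_m(z)\to\infty$ as $z\to\infty$. Moreover, $\gamma$ is the image of the positive imaginary half-axis, $\gamma(y)=\phi_m(iy)=u(y)+iv(y)$ for $y>0$, and satisfies the functional equation $$L\sin u(y)\,\sinh v(y)=y\qquad\text{for all } y>0.$$ -/

import Mathlib

open Set Filter Topology Polynomial

noncomputable section

/-- The set `[-1, -a] ∪ [a, 1]`. -/
def twoIntervals (a : ℝ) : Set ℝ := Icc (-1) (-a) ∪ Icc a 1

/-- The uniform deviation of `P` from `|x|` on `[-1, -a] ∪ [a, 1]`. -/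
def deviation (a : ℝ) (P : ℝ[X]) : ℝ :=
  sSup ((fun x : ℝ => |(|x|) - P.eval x|) '' twoIntervals a)

/-- The error `L_m(a)` of the best uniform approximation of `|x|` on `[-1, -a] ∪ [a, 1]`
by polynomials of degree at most `2m`. -/
def approxError (m : ℕ) (a : ℝ) : ℝ :=
  sInf (deviation a '' {P : ℝ[X] | P.natDegree ≤ 2 * m})

/-- `P` is a best uniform approximation of `|x|` by polynomials of degree at most `2m`. -/
def IsBestApprox (m : ℕ) (a : ℝ) (P : ℝ[X]) : Prop :=
  P.natDegree ≤ 2 * m ∧ deviation a P = approxError m a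

/-- The open first quadrant. -/
def openQuadrant : Set ℂ := {z | 0 < z.re ∧ 0 < z.im}

/-- The closed first quadrant. -/
def closedQuadrant : Set ℂ := {z | 0 ≤ z.re ∧ 0 ≤ z.im}

/-- The open half-strip `0 < u < W`, `v > 0`. -/
def halfStrip (W : ℝ) : Set ℂ := {w | 0 < w.re ∧ w.re < W ∧ 0 < w.im}

/-- `γ : (0, ∞) → ℂ` is a simple curve inside the half-strip of width `W` that starts at the
point `i v₀` of its left side and runs to infinity. -/
structure IsCrosscut (W : ℝ) (γ : ℝ → ℂ) (v₀ : ℝ) : Prop where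
  continuousOn : ContinuousOn γ (Ioi 0)
  injOn : InjOn γ (Ioi 0)
  mapsTo : MapsTo γ (Ioi 0) (halfStrip W)
  start_pos : 0 < v₀
  tendsto_start : Tendsto γ (𝓝[>] 0) (𝓝 ((v₀ : ℂ) * Complex.I))
  tendsto_end : Tendsto (fun y => (γ y).im) atTop atTop

/-- `G` is the region in the half-strip of width `W` bounded on the left by the curve `γ` (which
starts at `i v₀`): it is the connected component of the half-strip cut along `γ` whose boundary
consists of `γ`, the part `[0, i v₀]` of the left side below `γ`, the whole bottom side `[0, W]`,
and the whole right side. -/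
structure IsRegionBoundedOnLeft (W : ℝ) (γ : ℝ → ℂ) (v₀ : ℝ) (G : Set ℂ) : Prop where
  component : ∃ w ∈ halfStrip W \ γ '' Ioi 0,
    G = connectedComponentIn (halfStrip W \ γ '' Ioi 0) w
  frontier_eq : frontier G =
    γ '' Ioi 0 ∪ (fun t : ℝ => (t : ℂ) * Complex.I) '' Icc 0 v₀
      ∪ (fun t : ℝ => (t : ℂ)) '' Icc 0 W
      ∪ (fun t : ℝ => (W : ℂ) + (t : ℂ) * Complex.I) '' Ici 0

/-- `φ` maps the open first quadrant conformally onto `G`, extends continuously to the closed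
first quadrant, and satisfies `φ(a) = 0`, `φ(1) = W`, `φ(∞) = ∞`. -/
structure IsNormalizedConformalMap (a W : ℝ) (φ : ℂ → ℂ) (G : Set ℂ) : Prop where
  differentiableOn : DifferentiableOn ℂ φ openQuadrant
  injOn : InjOn φ openQuadrant
  image_eq : φ '' openQuadrant = G
  continuousOn : ContinuousOn φ closedQuadrant
  map_a : φ (a : ℂ) = 0
  map_one : φ 1 = (W : ℂ)
  map_infty : Tendsto φ (Bornology.cobounded ℂ ⊓ 𝓟 closedQuadrant) (Bornology.cobounded ℂ)

end

/-! The approximant is found among the even polynomials `Q(x²)`. A best `Q` exists by compactness. A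
critical point of `Q(x²) - x` is a point where `Q'(t)` meets `t^(-1/2)/2` at `t = x²`, so by
repeated Rolle there are at most `m` positive ones. With a perturbation argument this forces exactly
`m + 2` extremal points on `[a, 1]`, namely `a`, `1` and `m` interior critical points, with
alternating errors `±L` (`exists_equioscillates`). The same Rolle argument gives `Q' > 0` and `Q'' ≤
0` on `(-∞, 0]`. Reflecting the nodes gives enough sign changes on both intervals for uniqueness
among all polynomials of degree at most `2m` (`eq_of_deviation_le`).

The map is `φ = arccos((Q(z²) - z)/L)`. A branch exists on the quadrant because `Q(z²) - z` omits
`[-L, L]` there (`aeval_sub_ne`): for `|w| < L` the `m + 1` real solutions of `Q(t²) - t = w` are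
divided out, and the cofactor over the reflected factors has positive real part by
Phragmén–Lindelöf. Writing `φ = u + iv`, the real and imaginary parts of `L cos φ` determine the
boundary values. On the real axis `φ` runs down the left side, along the base and up the right side.
On the imaginary axis the imaginary part is precisely the functional equation `L sin u sinh v = y`.

Conformality rests on monotonicity. `u` increases along the positive real axis and, by the signs of
`Q'` and `Q''`, along the positive imaginary axis (`imag_re_lt`). The maximum principle applied to
`φ(cz) - φ(z)` shows that `u` increases along every ray from the origin, hence `Re(z φ'(z)) > 0`
(`re_mul_deriv_pos`). Thus `φ ∘ exp` has a derivative with positive real part on a convex strip, and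
is injective by the Noshiro–Warschawski argument (`eq_of_map_eq`). Since `φ` is proper on the closed
quadrant, the frontier of the image is read off the boundary values, and the image is a component of
the cut half-strip. -/

/-! ### Interpolation of negative powers by polynomials, via Rolle -/

/-- Rolle's theorem applied between consecutive zeros. -/
lemma exists_deriv_zeros_between {f f' : ℝ → ℝ} {z : ℕ → ℝ} {n : ℕ} (h0 : 0 < z 0)
    (hz : ∀ i < n, z i < z (i + 1)) (hf : ∀ t, 0 < t → HasDerivAt f (f' t) t)
    (hzero : ∀ i ≤ n, f (z i) = 0) :
    ∃ z' : ℕ → ℝ, ∀ i < n, z i < z' i ∧ z' i < z (i + 1) ∧ f' (z' i) = 0 := by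
  have hpos : ∀ i ≤ n, 0 < z i := by
    intro i
    induction i with
    | zero => intro _; exact h0
    | succ k ih => intro hk; exact (ih (by omega)).trans (hz k (by omega))
  have : ∀ i, ∃ c, i < n → z i < c ∧ c < z (i + 1) ∧ f' c = 0 := by
    intro i
    by_cases hi : i < n
    · obtain ⟨c, hc, hc'⟩ := exists_hasDerivAt_eq_zero (f := f) (f' := f') (hz i hi)
        (fun t ht => (hf t ((hpos i hi.le).trans_le ht.1)).continuousAt.continuousWithinAt)
        (by rw [hzero i hi.le, hzero (i + 1) hi])
        (fun t ht => hf t ((hpos i hi.le).trans ht.1))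
      exact ⟨c, fun _ => ⟨hc.1, hc.2, hc'⟩⟩
    · exact ⟨0, fun h => absurd h hi⟩
  choose z' hz' using this
  exact ⟨z', hz'⟩

/-- The minus sign is pulled out so that the derivative has the same shape, with `(Q, c, α)`
replaced by `(-Q', -cα, α - 1)`. Positivity of the constant and negativity of the exponent persist,
which drives the inductions below. -/
lemma hasDerivAt_eval_sub_rpow (Q : ℝ[X]) (c α t : ℝ) (ht : 0 < t) :
    HasDerivAt (fun t => Q.eval t - c * t ^ α)
      (-((-derivative Q).eval t - c * -α * t ^ (α - 1))) t := by
  have := (Q.hasDerivAt t).sub ((Real.hasDerivAt_rpow_const (p := α) (Or.inl ht.ne')).const_mul c)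
  refine this.congr_deriv ?_
  rw [eval_neg]; ring

/-- A polynomial of degree at most `n` that interpolates `c t ^ α` (`c > 0`, `α < 0`) at `n + 1`
positive points is positive to the left of these points. -/
lemma eval_pos_of_interpolates_rpow (n : ℕ) : ∀ (Q : ℝ[X]) (c α : ℝ) (z : ℕ → ℝ),
    Q.natDegree ≤ n → 0 < c → α < 0 → 0 < z 0 → (∀ i < n, z i < z (i + 1)) →
    (∀ i ≤ n, Q.eval (z i) - c * z i ^ α = 0) → ∀ t ≤ z 0, 0 < Q.eval t := by
  induction n with
  | zero =>
    intro Q c α z hQ hc hα h0 hz hzero t ht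
    rw [eq_C_of_natDegree_le_zero hQ] at hzero ⊢
    have := hzero 0 le_rfl
    simp only [eval_C] at this ⊢
    have h2 : 0 < c * z 0 ^ α := by positivity
    linarith
  | succ n ih =>
    intro Q c α z hQ hc hα h0 hz hzero t ht
    obtain ⟨z', hz'⟩ := exists_deriv_zeros_between h0 hz
      (fun t ht => hasDerivAt_eval_sub_rpow Q c α t ht) hzero
    have hneg : ∀ t ≤ z' 0, 0 < (-derivative Q).eval t := by
      refine ih (-derivative Q) (c * -α) (α - 1) z' ?_ (by nlinarith) (by linarith)
        (h0.trans (hz' 0 (by omega)).1)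
        (fun i hi => (hz' i (by omega)).2.1.trans (hz' (i + 1) (by omega)).1)
        (fun i hi => by have := (hz' i (by omega)).2.2; linarith)
      rw [natDegree_neg]
      exact (natDegree_derivative_le Q).trans (by omega)
    -- `Q` decreases up to `z' 0 > z 0`, so to the left of `z 0` it is at least `Q(z 0) = c (z 0)^α
    -- > 0`.
    have hanti : AntitoneOn (fun t => Q.eval t) (Iic (z' 0)) := by
      refine antitoneOn_of_deriv_nonpos (convex_Iic _) Q.continuous.continuousOn
        Q.differentiable.differentiableOn ?_
      intro x hx
      rw [interior_Iic] at hx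
      have := hneg x (le_of_lt hx)
      rw [Polynomial.deriv]; simp only [eval_neg] at this; linarith
    have h1 := (hz' 0 (by omega)).1
    have h2 := hanti (mem_Iic.2 (ht.trans h1.le)) (mem_Iic.2 h1.le) ht
    have h3 := hzero 0 (by omega)
    have h4 : 0 < c * z 0 ^ α := by positivity
    simp only at h2
    linarith

/-- A polynomial of degree at most `n` agrees with `c t ^ α` (`c > 0`, `α < 0`) in at most `n + 1`
positive points. -/
lemma false_of_interpolates_rpow (n : ℕ) : ∀ (Q : ℝ[X]) (c α : ℝ) (z : ℕ → ℝ),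
    Q.natDegree ≤ n → 0 < c → α < 0 → 0 < z 0 → (∀ i < n + 1, z i < z (i + 1)) →
    (∀ i ≤ n + 1, Q.eval (z i) - c * z i ^ α = 0) → False := by
  induction n with
  | zero =>
    intro Q c α z hQ hc hα h0 hz hzero
    obtain ⟨z', hz'⟩ := exists_deriv_zeros_between h0 hz
      (fun t ht => hasDerivAt_eval_sub_rpow Q c α t ht) hzero
    have h1 := hz' 0 (by omega)
    rw [eq_C_of_natDegree_le_zero hQ] at h1
    have h3 : 0 < z' 0 := h0.trans h1.1
    have h4 : 0 < c * -α * z' 0 ^ (α - 1) := mul_pos (mul_pos hc (by linarith)) (by positivity)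
    have h5 := h1.2.2
    simp at h5
    rcases h5 with (h5 | h5) | h5
    · linarith
    · linarith
    · rw [h5] at h4; simp at h4
  | succ n ih =>
    intro Q c α z hQ hc hα h0 hz hzero
    obtain ⟨z', hz'⟩ := exists_deriv_zeros_between h0 hz
      (fun t ht => hasDerivAt_eval_sub_rpow Q c α t ht) hzero
    refine ih (-derivative Q) (c * -α) (α - 1) z' ?_ (by nlinarith) (by linarith)
        (h0.trans (hz' 0 (by omega)).1)
        (fun i hi => (hz' i (by omega)).2.1.trans (hz' (i + 1) (by omega)).1)
        (fun i hi => by have := (hz' i (by omega)).2.2; linarith)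
    rw [natDegree_neg]
    exact (natDegree_derivative_le Q).trans (by omega)

lemma half_mul_sq_rpow {x : ℝ} (hx : 0 < x) :
    (1 / 2 : ℝ) * (x ^ 2) ^ (-(1 / 2) : ℝ) = 1 / (2 * x) := by
  rw [← Real.rpow_natCast, ← Real.rpow_mul hx.le]
  norm_num [Real.rpow_neg_one]
  ring

/-- Division by `2x` turns critical points of `Q(x²) - x` into agreement points of `Q'(t)` and
`t^(-1/2)/2` in the variable `t = x²`. -/
lemma critical_iff {Q : ℝ[X]} {x : ℝ} (hx : 0 < x) :
    2 * x * (derivative Q).eval (x ^ 2) - 1 = 0 ↔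
      (derivative Q).eval (x ^ 2) - (1 / 2 : ℝ) * (x ^ 2) ^ (-(1 / 2) : ℝ) = 0 := by
  rw [half_mul_sq_rpow hx]
  constructor
  · intro h; field_simp; linarith
  · intro h; field_simp at h; linarith

/-- `Q(x²) - x` has at most `deg Q` positive critical points. -/
lemma card_critical_le {m : ℕ} (hm : 1 ≤ m) {Q : ℝ[X]} (hQ : Q.natDegree ≤ m) (s : Finset ℝ)
    (hs : ∀ x ∈ s, 0 < x ∧ 2 * x * (derivative Q).eval (x ^ 2) - 1 = 0) : s.card ≤ m := by
  by_contra hcard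
  push Not at hcard
  obtain ⟨t, hts, htc⟩ := Finset.exists_subset_card_eq (Nat.succ_le_of_lt hcard)
  have hmem : ∀ i, t.orderEmbOfFin htc i ∈ s := fun i => hts (Finset.orderEmbOfFin_mem t htc i)
  -- The squares of `m + 1` critical points in increasing order; the default value is never read.
  let z : ℕ → ℝ := fun i => if h : i < m.succ then (t.orderEmbOfFin htc ⟨i, h⟩) ^ 2 else 0
  refine false_of_interpolates_rpow (m - 1) (derivative Q) (1 / 2) (-(1 / 2)) z
    ((natDegree_derivative_le Q).trans (by omega)) (by norm_num) (by norm_num) ?_ ?_ ?_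
  · have : (0 : ℕ) < m.succ := by omega
    simp only [z, this, dif_pos]
    have := (hs _ (hmem ⟨0, this⟩)).1
    positivity
  · intro i hi
    have h1 : i < m.succ := by omega
    have h2 : i + 1 < m.succ := by omega
    simp only [z, h1, h2, dif_pos]
    have h3 := (hs _ (hmem ⟨i, h1⟩)).1
    have h4 : t.orderEmbOfFin htc ⟨i, h1⟩ < t.orderEmbOfFin htc ⟨i + 1, h2⟩ := by
      simp
    exact pow_lt_pow_left₀ h4 h3.le (by norm_num)
  · intro i hi
    have h1 : i < m.succ := by omega
    simp only [z, h1, dif_pos]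
    have h3 := hs _ (hmem ⟨i, h1⟩)
    exact (critical_iff h3.1).1 h3.2

/-! ### Best even approximation and its extremal points -/

/-- Existence of a best approximation of `x` by even polynomials on `[a, 1]`. -/
lemma exists_best_even {a : ℝ} (ha0 : 0 < a) (ha1 : a < 1) (m : ℕ) :
    ∃ (Q : ℝ[X]) (L : ℝ), 0 < L ∧ Q.natDegree ≤ m ∧
      (∀ x ∈ Icc a 1, |Q.eval (x ^ 2) - x| ≤ L) ∧
      ∀ Q' : ℝ[X], Q'.natDegree ≤ m → ¬ ∀ x ∈ Icc a 1, |Q'.eval (x ^ 2) - x| < L := by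
  -- An even polynomial is not the identity on an interval: compare the values at `1` and `-1`. This
  -- makes the minimal error positive.
  have hpt : ∀ Q : ℝ[X], (∀ x ∈ Icc a 1, Q.eval (x ^ 2) - x = 0) → False := by
    intro Q hQ
    have h0 : Q.comp (X ^ 2) - X = 0 := by
      refine Polynomial.eq_zero_of_infinite_isRoot _ ((Icc_infinite ha1).mono ?_)
      intro x hx
      simpa [IsRoot] using hQ x hx
    have h1 := congrArg (eval 1) h0
    have h2 := congrArg (eval (-1)) h0
    simp at h1 h2
    linarith
  let T : degreeLT ℝ (m + 1) →ₗ[ℝ] C(Icc a 1, ℝ) :=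
    { toFun := fun Q => ⟨fun x => (Q : ℝ[X]).eval ((x : ℝ) ^ 2), by fun_prop⟩
      map_add' := fun p q => by ext x; simp
      map_smul' := fun c p => by ext x; simp }
  let f : C(Icc a 1, ℝ) := ⟨fun x => x, by fun_prop⟩
  have hT : LinearMap.ker T = ⊥ := by
    rw [LinearMap.ker_eq_bot']
    intro Q hQ
    have h0 : (Q : ℝ[X]).comp (X ^ 2) = 0 := by
      refine Polynomial.eq_zero_of_infinite_isRoot _ ((Icc_infinite ha1).mono ?_)
      intro x hx
      have := DFunLike.congr_fun hQ ⟨x, hx⟩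
      simpa [IsRoot, T] using this
    rw [comp_eq_zero_iff] at h0
    rcases h0 with h | ⟨-, h⟩
    · exact Subtype.ext h
    · exfalso
      have := congrArg natDegree h
      simp at this
  have hdeg : ∀ Q : ℝ[X], Q ∈ degreeLT ℝ (m + 1) ↔ Q.natDegree ≤ m := by
    intro Q
    rw [mem_degreeLT, degree_lt_iff_coeff_zero, natDegree_le_iff_coeff_eq_zero]
    constructor
    · exact fun h N hN => h N (by omega)
    · exact fun h N hN => h N (by omega)
  let e := (degreeLTEquiv ℝ (m + 1)).symm
  let S : (Fin (m + 1) → ℝ) →ₗ[ℝ] C(Icc a 1, ℝ) := T ∘ₗ e.toLinearMap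
  have hS : LinearMap.ker S = ⊥ := by
    rw [LinearMap.ker_eq_bot] at hT ⊢
    exact hT.comp e.injective
  -- An injective linear map from a finite-dimensional space is bounded below, so the error is a
  -- coercive function of the coefficients and attains its minimum.
  obtain ⟨K, hK0, hK⟩ := S.exists_antilipschitzWith hS
  have hcont : Continuous fun c => ‖S c - f‖ :=
    (S.continuous_of_finiteDimensional.sub continuous_const).norm
  have hlim : Tendsto (fun c => ‖S c - f‖) (cocompact _) atTop := by
    have h1 : Tendsto (fun c : Fin (m + 1) → ℝ => (K : ℝ)⁻¹ * ‖c‖ - ‖f‖) (cocompact _) atTop :=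
      tendsto_atTop_add_const_right _ _
        (tendsto_norm_cocompact_atTop.const_mul_atTop (inv_pos.2 (by exact_mod_cast hK0)))
    refine tendsto_atTop_mono (fun c => ?_) h1
    have h2 : ‖c‖ ≤ K * ‖S c‖ := by
      have := hK.le_mul_dist c 0
      simpa using this
    have h3 : (K : ℝ)⁻¹ * ‖c‖ ≤ ‖S c‖ := by
      rw [inv_mul_le_iff₀ (by exact_mod_cast hK0)]; exact h2
    have h4 := norm_sub_norm_le (S c) f
    linarith
  obtain ⟨c, hc⟩ := hcont.exists_forall_le hlim
  have hval : ∀ c (x : Icc a 1), (S c - f) x = ((e c : ℝ[X])).eval ((x : ℝ) ^ 2) - x :=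
    fun c x => rfl
  have hpos : 0 < ‖S c - f‖ := by
    rw [norm_pos_iff]
    intro h
    refine hpt (e c) fun x hx => ?_
    rw [← hval c ⟨x, hx⟩, h]; rfl
  refine ⟨e c, ‖S c - f‖, hpos, (hdeg _).1 (e c).2, fun x hx => ?_, fun Q' hQ' h => ?_⟩
  · rw [← hval c ⟨x, hx⟩]
    exact (S c - f).norm_coe_le_norm ⟨x, hx⟩
  · have h1 := hc (e.symm ⟨Q', (hdeg _).2 hQ'⟩)
    have h2 : ‖S (e.symm ⟨Q', (hdeg _).2 hQ'⟩) - f‖ < ‖S c - f‖ := by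
      rw [ContinuousMap.norm_lt_iff _ hpos]
      rintro ⟨x, hx⟩
      rw [hval, LinearEquiv.apply_symm_apply]
      exact h x hx
    exact absurd h1 (not_le.2 h2)

/-- A perturbation with the sign of the error at the extremal points decreases the error. -/
lemma exists_perturbation_lt {K : Set ℝ} (hK : IsCompact K) {r q : ℝ → ℝ} (hr : Continuous r)
    (hq : Continuous q) {L : ℝ} (hL : 0 < L) (hle : ∀ x ∈ K, |r x| ≤ L)
    (hsign : ∀ x ∈ K, |r x| = L → 0 < r x * q x) :
    ∃ ε : ℝ, ∀ x ∈ K, |r x - ε * q x| < L := by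
  -- Compactness reduces the claim to neighbourhoods of the points `(0, x)` in the product. These
  -- also contain points with `ε ≤ 0` or off `K`, so both conditions are repeated inside the
  -- predicate.
  have key : ∀ᶠ ε in 𝓝 (0 : ℝ), ∀ x ∈ K, x ∈ K → 0 < ε → |r x - ε * q x| < L := by
    refine hK.eventually_forall_of_forall_eventually
      (P := fun ε x => x ∈ K → 0 < ε → |r x - ε * q x| < L) fun x hx => ?_
    rcases (hle x hx).lt_or_eq with h | h
    · have hc : ContinuousAt (fun z : ℝ × ℝ => |r z.2 - z.1 * q z.2|) (0, x) := by fun_prop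
      filter_upwards [hc.eventually_lt_const (by simpa using h)] with z hz _ _ using hz
    · have hc : ContinuousAt (fun z : ℝ × ℝ => |z.1 * q z.2|) (0, x) := by fun_prop
      have hc' : ContinuousAt (fun z : ℝ × ℝ => r z.2 * q z.2) (0, x) := by fun_prop
      filter_upwards [hc.eventually_lt_const (u := L) (by simpa using hL),
        hc'.eventually_const_lt (by simpa using hsign x hx h)] with z hz1 hz2 hzK hz0
      have h3 := hle _ hzK
      rw [abs_le] at h3
      rw [abs_lt] at hz1 ⊢
      rcases pos_and_pos_or_neg_and_neg_of_mul_pos hz2 with ⟨h4, h5⟩ | ⟨h4, h5⟩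
      · have := mul_pos hz0 h5
        constructor <;> linarith [h3.1, h3.2, hz1.1, hz1.2]
      · have := mul_neg_of_pos_of_neg hz0 h5
        constructor <;> linarith [h3.1, h3.2, hz1.1, hz1.2]
  obtain ⟨ε, h1, h2⟩ := ((key.filter_mono nhdsWithin_le_nhds).and
    (self_mem_nhdsWithin (s := Ioi (0 : ℝ)))).exists
  exact ⟨ε, fun x hx => h1 x hx hx h2⟩

/-- `Q(x²) - x` equioscillates between `±L` at the points `a = x₀ < ⋯ < x_{m+1} = 1`, and it is
strictly monotone between these points and beyond them. -/
structure Equioscillates (m : ℕ) (a L : ℝ) (Q : ℝ[X]) (x : ℕ → ℝ) : Prop where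
  error_pos : 0 < L
  natDegree_le : Q.natDegree ≤ m
  node_zero : x 0 = a
  node_last : x (m + 1) = 1
  node_lt : ∀ j ≤ m, x j < x (j + 1)
  value : ∀ j ≤ m + 1, Q.eval (x j ^ 2) - x j = (-1) ^ j * L
  abs_le : ∀ t ∈ Icc a 1, |Q.eval (t ^ 2) - t| ≤ L
  deriv_sign : ∀ j ≤ m, ∀ t ∈ Ioo (x j) (x (j + 1)),
    0 < (-1) ^ (j + 1) * (2 * t * (derivative Q).eval (t ^ 2) - 1)
  deriv_left : ∀ t, 0 ≤ t → t ≤ a → 2 * t * (derivative Q).eval (t ^ 2) - 1 < 0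
  deriv_right : ∀ t, 1 ≤ t → 0 < (-1) ^ (m + 1) * (2 * t * (derivative Q).eval (t ^ 2) - 1)
  derivative_pos : ∀ t ≤ 0, 0 < (derivative Q).eval t
  derivative_derivative_nonpos : ∀ t ≤ 0, (derivative (derivative Q)).eval t ≤ 0

lemma hasDerivAt_eval_sq_sub (Q : ℝ[X]) (t : ℝ) :
    HasDerivAt (fun t => Q.eval (t ^ 2) - t) (2 * t * (derivative Q).eval (t ^ 2) - 1) t := by
  have h := ((Q.hasDerivAt (t ^ 2)).comp t (hasDerivAt_pow 2 t)).sub (hasDerivAt_id t)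
  refine h.congr_deriv ?_
  push_cast; ring

lemma pos_of_ne_zero_of_pos {f : ℝ → ℝ} (hf : Continuous f) {s : Set ℝ} (hs : s.OrdConnected)
    (h0 : ∀ t ∈ s, f t ≠ 0) {c : ℝ} (hc : c ∈ s) (hfc : 0 < f c) : ∀ t ∈ s, 0 < f t := by
  intro t ht
  by_contra hneg
  push Not at hneg
  obtain ⟨y, hy, hy0⟩ := hs.isPreconnected.intermediate_value ht hc hf.continuousOn
    (show (0 : ℝ) ∈ Icc (f t) (f c) from ⟨hneg, hfc.le⟩)
  exact h0 y hy hy0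

/-- The extremal points of a best approximation: there are exactly `m + 2` of them. -/
lemma exists_extremal_nodes {m : ℕ} (hm : 1 ≤ m) {a : ℝ} (ha0 : 0 < a) {Q : ℝ[X]}
    {L : ℝ} (hL : 0 < L) (hQ : Q.natDegree ≤ m) (hle : ∀ x ∈ Icc a 1, |Q.eval (x ^ 2) - x| ≤ L)
    (hbest : ∀ Q' : ℝ[X], Q'.natDegree ≤ m → ¬ ∀ x ∈ Icc a 1, |Q'.eval (x ^ 2) - x| < L) :
    ∃ x : ℕ → ℝ, x 0 = a ∧ x (m + 1) = 1 ∧ (∀ j ≤ m, x j < x (j + 1)) ∧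
      (∀ j ≤ m + 1, |Q.eval (x j ^ 2) - x j| = L) ∧
      (∀ t, 0 < t → 2 * t * (derivative Q).eval (t ^ 2) - 1 = 0 →
        ∃ j, 1 ≤ j ∧ j ≤ m ∧ t = x j) ∧
      (∀ j, 1 ≤ j → j ≤ m → 2 * x j * (derivative Q).eval (x j ^ 2) - 1 = 0) := by
  set d : ℝ → ℝ := fun t => 2 * t * (derivative Q).eval (t ^ 2) - 1 with hd
  set Z : Set ℝ := {t | 0 < t ∧ d t = 0} with hZ
  have hZfin : Z.Finite := by
    by_contra hinf
    obtain ⟨s, hs, hcard⟩ := Set.Infinite.exists_subset_card_eq hinf (m + 1)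
    have := card_critical_le hm hQ s (fun x hx => hs hx)
    omega
  set E : Set ℝ := {t | t ∈ Icc a 1 ∧ |Q.eval (t ^ 2) - t| = L} with hE
  have hEsub : ∀ t ∈ E, t ≠ a → t ≠ 1 → t ∈ Z := by
    intro t ht hta ht1
    have hta' : a < t := lt_of_le_of_ne ht.1.1 (Ne.symm hta)
    have ht1' : t < 1 := lt_of_le_of_ne ht.1.2 ht1
    refine ⟨ha0.trans hta', ?_⟩
    have hnhds : Icc a 1 ∈ 𝓝 t := Icc_mem_nhds hta' ht1'
    rcases abs_eq hL.le |>.1 ht.2 with h | h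
    · have : IsLocalMax (fun t => Q.eval (t ^ 2) - t) t := by
        filter_upwards [hnhds] with s hs
        rw [h]; exact (abs_le.1 (hle s hs)).2
      exact this.hasDerivAt_eq_zero (hasDerivAt_eval_sq_sub Q t)
    · have : IsLocalMin (fun t => Q.eval (t ^ 2) - t) t := by
        filter_upwards [hnhds] with s hs
        rw [h]; exact (abs_le.1 (hle s hs)).1
      exact this.hasDerivAt_eq_zero (hasDerivAt_eval_sq_sub Q t)
  have hEfin : E.Finite := by
    refine (hZfin.insert 1 |>.insert a).subset fun t ht => ?_
    by_cases h1 : t = a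
    · exact Or.inl h1
    by_cases h2 : t = 1
    · exact Or.inr (Or.inl h2)
    exact Or.inr (Or.inr (hEsub t ht h1 h2))
  set F := hEfin.toFinset with hF
  have hmemF : ∀ {t}, t ∈ F ↔ t ∈ E := hEfin.mem_toFinset
  have hFpos : ∀ t ∈ F, 0 < t := fun t ht => ha0.trans_le (hmemF.1 ht).1.1
  -- With at most `m + 1` extremal points, a polynomial of degree at most `m` in `t²` interpolates
  -- the error at all of them. Subtracting a small multiple of it would improve the best
  -- approximation.
  have hcard : m + 2 ≤ F.card := by
    by_contra hlt
    push Not at hlt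
    have hinj : Set.InjOn (fun t : ℝ => t ^ 2) F := by
      intro s hs t ht hst
      exact (sq_eq_sq₀ (hFpos s hs).le (hFpos t ht).le).1 hst
    set q := Lagrange.interpolate F (fun t : ℝ => t ^ 2) (fun t => Q.eval (t ^ 2) - t) with hq
    have hqdeg : q.natDegree ≤ m := by
      have h1 := Lagrange.degree_interpolate_lt (fun t => Q.eval (t ^ 2) - t) hinj
      rw [natDegree_le_iff_degree_le]
      have h2 : q.degree < ((m + 1 : ℕ) : WithBot ℕ) :=
        h1.trans_le (by exact_mod_cast (by omega : F.card ≤ m + 1))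
      rw [degree_lt_iff_coeff_zero] at h2
      rw [degree_le_iff_coeff_zero]
      intro n hn
      exact h2 n (by exact_mod_cast hn)
    obtain ⟨ε, hε⟩ := exists_perturbation_lt (K := Icc a 1) isCompact_Icc
      (r := fun t => Q.eval (t ^ 2) - t) (q := fun t => q.eval (t ^ 2))
      (by fun_prop) (by fun_prop) hL hle (by
        intro t ht htL
        have := Lagrange.eval_interpolate_at_node (fun t => Q.eval (t ^ 2) - t) hinj
          (hmemF.2 ⟨ht, htL⟩)
        rw [hq, this]
        refine mul_self_pos.2 fun h => ?_
        rw [h] at htL; simp at htL; linarith)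
    refine hbest (Q - C ε * q) ?_ fun t ht => ?_
    · refine (natDegree_sub_le _ _).trans (max_le hQ ((natDegree_C_mul_le _ _).trans hqdeg))
    · have := hε t ht
      simp only [eval_sub, eval_mul, eval_C]
      convert this using 2; ring
  -- Extremal points other than `a` and `1` are critical, hence at most `m` in number. Against the
  -- lower bound `m + 2`, both endpoints are extremal and every inequality is an equality.
  have hsub : ((F.erase a).erase 1).card ≤ m := by
    refine card_critical_le hm hQ _ fun t ht => ?_
    simp only [Finset.mem_erase] at ht
    exact hEsub t (hmemF.1 ht.2.2) ht.2.1 ht.1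
  have h1F : (1 : ℝ) ∈ F.erase a := by
    by_contra h
    rw [Finset.erase_eq_of_notMem h] at hsub
    have := Finset.pred_card_le_card_erase (s := F) (a := a)
    omega
  have haF : a ∈ F := by
    by_contra h
    rw [Finset.erase_eq_of_notMem h] at hsub
    have := Finset.pred_card_le_card_erase (s := F) (a := 1)
    omega
  have hFcard : F.card = m + 2 := by
    rw [Finset.card_erase_of_mem h1F, Finset.card_erase_of_mem haF] at hsub
    omega
  have h1F' := Finset.mem_of_mem_erase h1F
  set o := F.orderEmbOfFin hFcard with ho
  have hoF : ∀ i, o i ∈ F := Finset.orderEmbOfFin_mem F hFcard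
  have hsurj : ∀ t ∈ F, ∃ i, o i = t := by
    intro t ht
    have := Finset.range_orderEmbOfFin F hFcard
    have h2 : t ∈ Set.range (F.orderEmbOfFin hFcard) := by rw [this]; exact ht
    exact h2
  let x : ℕ → ℝ := fun j => if h : j < m + 2 then o ⟨j, h⟩ else 0
  have hx : ∀ j (h : j < m + 2), x j = o ⟨j, h⟩ := fun j h => by simp only [x, h, dif_pos]
  have hx0 : x 0 = a := by
    obtain ⟨i, hi⟩ := hsurj a haF
    rw [hx 0 (by omega)]
    refine le_antisymm ?_ (hmemF.1 (hoF _)).1.1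
    exact (o.monotone (Fin.zero_le i)).trans_eq hi
  have hxl : x (m + 1) = 1 := by
    obtain ⟨i, hi⟩ := hsurj 1 h1F'
    rw [hx (m + 1) (by omega)]
    refine le_antisymm (hmemF.1 (hoF _)).1.2 ?_
    exact hi.symm.trans_le (o.monotone (Fin.le_last i))
  have hlt : ∀ i j, i < j → j < m + 2 → x i < x j := by
    intro i j hij hj
    rw [hx i (by omega), hx j hj]
    exact o.strictMono hij
  have hcrit : ∀ j, 1 ≤ j → j ≤ m → x j ∈ Z := by
    intro j h1 h2
    have h3 := hlt 0 j (by omega) (by omega)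
    have h4 := hlt j (m + 1) (by omega) (by omega)
    rw [hx0] at h3
    rw [hxl] at h4
    refine hEsub _ ?_ h3.ne' h4.ne
    rw [hx j (by omega)]
    exact hmemF.1 (hoF _)
  refine ⟨x, hx0, hxl, fun j hj => hlt j (j + 1) (by omega) (by omega), ?_, ?_,
    fun j h1 h2 => (hcrit j h1 h2).2⟩
  · intro j hj
    rw [hx j (by omega)]
    exact (hmemF.1 (hoF _)).2
  · intro t ht0 ht
    by_contra hne
    push Not at hne
    -- The `m` interior nodes already exhaust the permitted number of critical points.
    have hcard2 : (insert t ((Finset.Icc 1 m).image x)).card = m + 1 := by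
      rw [Finset.card_insert_of_notMem, Finset.card_image_of_injOn]
      · simp
      · intro i hi j hj hij
        simp only [Finset.coe_Icc, mem_Icc] at hi hj
        rcases lt_trichotomy i j with h | h | h
        · exact absurd hij (hlt i j h (by omega)).ne
        · exact h
        · exact absurd hij (hlt j i h (by omega)).ne'
      · intro h
        obtain ⟨j, hj, hjt⟩ := Finset.mem_image.1 h
        rw [Finset.mem_Icc] at hj
        exact hne j hj.1 hj.2 hjt.symm
    have := card_critical_le hm hQ (insert t ((Finset.Icc 1 m).image x)) (by
      intro s hs
      rcases Finset.mem_insert.1 hs with rfl | h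
      · exact ⟨ht0, ht⟩
      · obtain ⟨j, hj, rfl⟩ := Finset.mem_image.1 h
        rw [Finset.mem_Icc] at hj
        exact hcrit j hj.1 hj.2)
    omega

/-- The critical points are exactly the interior nodes, so the error is strictly monotone between
neighbours and the values `±L` must alternate. The signs of `Q'` and `Q''` on `(-∞, 0]` come from
`eval_pos_of_interpolates_rpow`: `Q'` interpolates `t^(-1/2)/2` at the squares of the `m` interior
nodes, and Rolle gives `m - 1` analogous points for `-Q''`. -/
lemma exists_equioscillates {m : ℕ} (hm : 1 ≤ m) {a : ℝ} (ha0 : 0 < a) (ha1 : a < 1) :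
    ∃ (L : ℝ) (Q : ℝ[X]) (x : ℕ → ℝ), Equioscillates m a L Q x := by
  obtain ⟨Q, L, hL, hQ, hle, hbest⟩ := exists_best_even ha0 ha1 m
  obtain ⟨x, hx0, hxl, hlt, hext, hcrit, hcrit'⟩ :=
    exists_extremal_nodes hm ha0 hL hQ hle hbest
  have hltij : ∀ i j, i < j → j ≤ m + 1 → x i < x j := by
    intro i j hij
    induction j, hij using Nat.le_induction with
    | base => intro h; exact hlt i (by omega)
    | succ j hj ih => intro h; exact (ih (by omega)).trans (hlt j (by omega))
  have hleij : ∀ i j, i ≤ j → j ≤ m + 1 → x i ≤ x j := by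
    intro i j hij hj
    rcases hij.eq_or_lt with rfl | h
    · exact le_rfl
    · exact (hltij i j h hj).le
  have hpos : ∀ j ≤ m + 1, 0 < x j := fun j hj =>
    ha0.trans_le (hx0 ▸ hleij 0 j (by omega) hj)
  set d : ℝ → ℝ := fun t => 2 * t * (derivative Q).eval (t ^ 2) - 1 with hd
  have hdc : Continuous d := by fun_prop
  have hderiv : ∀ t, HasDerivAt (fun t => Q.eval (t ^ 2) - t) (d t) t :=
    hasDerivAt_eval_sq_sub Q
  have hcont : Continuous fun t => Q.eval (t ^ 2) - t := by fun_prop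
  have hd_between : ∀ j ≤ m, ∀ t ∈ Ioo (x j) (x (j + 1)), d t ≠ 0 := by
    intro j hj t ht h0
    obtain ⟨k, hk1, hk2, rfl⟩ := hcrit t ((hpos j (by omega)).trans ht.1) h0
    rcases Nat.lt_or_ge k (j + 1) with h | h
    · exact absurd (hleij k j (by omega) (by omega)) (not_le.2 ht.1)
    · exact absurd (hleij (j + 1) k h (by omega)) (not_le.2 ht.2)
  have hd_left : ∀ t ∈ Ico 0 (x 1), d t < 0 := by
    have := pos_of_ne_zero_of_pos (f := fun t => - d t) hdc.neg (s := Ico 0 (x 1)) ordConnected_Ico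
      (by
        intro t ht h0
        have h0' : d t = 0 := neg_eq_zero.1 h0
        rcases ht.1.eq_or_lt with h | h
        · rw [← h] at h0'; simp [hd] at h0'
        · obtain ⟨k, hk1, hk2, rfl⟩ := hcrit t h h0'
          exact absurd (hleij 1 k (by omega) (by omega)) (not_le.2 ht.2))
      (c := 0) ⟨le_rfl, hpos 1 (by omega)⟩ (by simp [hd])
    intro t ht
    have := this t ht
    linarith
  -- The error has derivative `-1` at `0` and no critical point before `x 1`, so it decreases from
  -- `x 0` to `x 1`. This fixes the first sign.
  have hval0 : Q.eval (x 0 ^ 2) - x 0 = L := by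
    have h1 : StrictAntiOn (fun t => Q.eval (t ^ 2) - t) (Icc (x 0) (x 1)) := by
      refine strictAntiOn_of_deriv_neg (convex_Icc _ _) hcont.continuousOn ?_
      intro t ht
      rw [interior_Icc] at ht
      rw [(hderiv t).deriv]
      exact hd_left t ⟨(hpos 0 (by omega)).le.trans ht.1.le, ht.2⟩
    have h2 := h1 (left_mem_Icc.2 (hlt 0 (by omega)).le) (right_mem_Icc.2 (hlt 0 (by omega)).le)
      (hlt 0 (by omega))
    simp only at h2
    rcases abs_eq hL.le |>.1 (hext 0 (by omega)) with h | h
    · exact h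
    · have h3 := (abs_eq hL.le).1 (hext 1 (by omega))
      rcases h3 with h3 | h3 <;> linarith
  have hval : ∀ j ≤ m + 1, Q.eval (x j ^ 2) - x j = (-1) ^ j * L := by
    intro j
    induction j with
    | zero => intro _; simpa using hval0
    | succ j ih =>
      intro hj
      have h1 := ih (by omega)
      have h2 : Q.eval (x j ^ 2) - x j ≠ Q.eval (x (j + 1) ^ 2) - x (j + 1) := by
        intro h
        obtain ⟨c, hc, hc'⟩ := exists_hasDerivAt_eq_zero (f := fun t => Q.eval (t ^ 2) - t)
          (hlt j (by omega)) hcont.continuousOn h (fun t _ => hderiv t)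
        exact hd_between j (by omega) c hc hc'
      rcases neg_one_pow_eq_or ℝ j with h | h <;>
        rcases abs_eq hL.le |>.1 (hext (j + 1) hj) with h3 | h3 <;>
        rw [pow_succ (-1 : ℝ) j, h] <;> rw [h] at h1 <;> first | linarith | exact absurd (by linarith) h2
  -- The mean value theorem gives the sign of the derivative at one point of the gap, and
  -- nonvanishing spreads it over `s`. The larger `s` serves the region to the right of the last
  -- interior node.
  have hsign_of : ∀ j ≤ m, ∀ s : Set ℝ, s.OrdConnected → Ioo (x j) (x (j + 1)) ⊆ s →
      (∀ t ∈ s, d t ≠ 0) → ∀ t ∈ s, 0 < (-1) ^ (j + 1) * d t := by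
    intro j hj s hs hsub h0
    obtain ⟨c, hc, hc'⟩ := exists_hasDerivAt_eq_slope (fun t => Q.eval (t ^ 2) - t) d
      (hlt j hj) hcont.continuousOn (fun t _ => hderiv t)
    rw [hval j (by omega), hval (j + 1) (by omega)] at hc'
    refine pos_of_ne_zero_of_pos (f := fun t => (-1) ^ (j + 1) * d t) (hdc.const_mul _) hs ?_
      (hsub hc) ?_
    · intro t ht
      exact mul_ne_zero (pow_ne_zero _ (by norm_num)) (h0 t ht)
    · have h3 : 0 < x (j + 1) - x j := sub_pos.2 (hlt j hj)
      rw [hc', ← mul_div_assoc]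
      refine div_pos ?_ h3
      rcases neg_one_pow_eq_or ℝ j with h | h <;> rw [pow_succ, h] <;> nlinarith
  have hxn : 0 < x 1 ^ 2 := pow_pos (hpos 1 (by omega)) 2
  have hsq : ∀ i < m - 1, x (i + 1) ^ 2 < x (i + 1 + 1) ^ 2 := fun i hi =>
    pow_lt_pow_left₀ (hlt (i + 1) (by omega)) (hpos (i + 1) (by omega)).le (by norm_num)
  have hzero : ∀ i ≤ m - 1, (derivative Q).eval (x (i + 1) ^ 2)
      - 1 / 2 * (x (i + 1) ^ 2) ^ (-(1 / 2) : ℝ) = 0 := fun i hi =>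
    (critical_iff (hpos (i + 1) (by omega))).1 (hcrit' (i + 1) (by omega) (by omega))
  have hQ'deg : (derivative Q).natDegree ≤ m - 1 :=
    (natDegree_derivative_le Q).trans (by omega)
  refine ⟨L, Q, x, hL, hQ, hx0, hxl, hlt, hval, hle, ?_, ?_, ?_, ?_, ?_⟩
  · intro j hj
    exact hsign_of j hj _ ordConnected_Ioo subset_rfl (hd_between j hj)
  · intro t h0 h1
    exact hd_left t ⟨h0, h1.trans_lt (hx0 ▸ hlt 0 (by omega))⟩
  · intro t ht
    refine hsign_of m le_rfl (Ioi (x m)) ordConnected_Ioi (fun s hs => hs.1) ?_ t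
      ((hlt m le_rfl).trans_le (hxl ▸ ht))
    intro s hs h0
    obtain ⟨k, hk1, hk2, rfl⟩ := hcrit s ((hpos m (by omega)).trans hs) h0
    exact absurd (hleij k m (by omega) (by omega)) (not_le.2 hs)
  · intro t ht
    exact eval_pos_of_interpolates_rpow (m - 1) (derivative Q) (1 / 2) (-(1 / 2))
      (fun i => x (i + 1) ^ 2) hQ'deg (by norm_num) (by norm_num) hxn hsq hzero t
      (ht.trans hxn.le)
  · intro t ht
    rcases hm.eq_or_lt with rfl | hm2
    · rw [eq_C_of_natDegree_le_zero hQ'deg]; simp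
    obtain ⟨z', hz'⟩ := exists_deriv_zeros_between (z := fun i => x (i + 1) ^ 2) hxn hsq
      (fun t ht => hasDerivAt_eval_sub_rpow (derivative Q) (1 / 2) (-(1 / 2)) t ht) hzero
    have h0 : 0 < z' 0 := hxn.trans (hz' 0 (by omega)).1
    have := eval_pos_of_interpolates_rpow (m - 2) (-derivative (derivative Q))
      (1 / 2 * -(-(1 / 2))) (-(1 / 2) - 1) z' (by
        rw [natDegree_neg]; exact (natDegree_derivative_le _).trans (by omega))
      (by norm_num) (by norm_num) h0
      (fun i hi => (hz' i (by omega)).2.1.trans (hz' (i + 1) (by omega)).1)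
      (fun i hi => by have := (hz' i (by omega)).2.2; linarith) t (ht.trans h0.le)
    rw [eval_neg] at this
    linarith

/-! ### Uniqueness of the best approximation -/

/-- A polynomial of degree at most `n` whose values alternate weakly in sign at `n + 2` points
vanishes. -/
lemma eq_zero_of_weakly_alternating {N n : ℕ} {D : ℝ[X]} (hD : D.natDegree ≤ n) (hN : n + 1 < N)
    {y : ℕ → ℝ} (hy : ∀ i j, i < j → j < N → y i < y j) {σ : ℝ} (hσ : σ ≠ 0)
    (hs : ∀ k < N, 0 ≤ (-1) ^ k * σ * D.eval (y k)) : D = 0 := by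
  have hinj : Set.InjOn y (Finset.range N) := by
    intro i hi j hj hij
    simp only [Finset.coe_range, mem_Iio] at hi hj
    rcases lt_trichotomy i j with h | h | h
    · exact absurd hij (hy i j h hj).ne
    · exact h
    · exact absurd hij (hy j i h hi).ne'
  have hdeg : D.degree < (Finset.range N).card := by
    rw [Finset.card_range]
    exact (natDegree_le_iff_degree_le.1 hD).trans_lt (by exact_mod_cast (by omega : n < N))
  -- The coefficient of `X^(N - 1)` is zero and equals the sum of `D(y i) / ∏ (y i - y j)`. The
  -- products alternate in sign, as do the values of `D`, so the terms share one sign and each of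
  -- them vanishes.
  have hsum := Lagrange.coeff_eq_sum hinj hdeg
  rw [Finset.card_range, coeff_eq_zero_of_natDegree_lt (by omega)] at hsum
  have hw : ∀ i < N, 0 < (-1) ^ (N - 1 - i) * ∏ j ∈ (Finset.range N).erase i, (y i - y j) := by
    intro i hi
    have h1 : (Finset.range N).erase i = Finset.range i ∪ Finset.Ioo i N := by
      ext j; simp; omega
    have h2 : Disjoint (Finset.range i) (Finset.Ioo i N) := by
      rw [Finset.disjoint_left]; intro j; simp; omega
    rw [h1, Finset.prod_union h2]
    have h3 : (-1 : ℝ) ^ (N - 1 - i) = ∏ j ∈ Finset.Ioo i N, (-1 : ℝ) := by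
      rw [Finset.prod_const, Nat.card_Ioo]; congr 1; omega
    rw [h3, mul_left_comm, ← Finset.prod_mul_distrib]
    refine mul_pos (Finset.prod_pos fun j hj => ?_) (Finset.prod_pos fun j hj => ?_)
    · exact sub_pos.2 (hy j i (Finset.mem_range.1 hj) hi)
    · have := hy i j (Finset.mem_Ioo.1 hj).1 (Finset.mem_Ioo.1 hj).2
      linarith
  have hterm : ∀ i ∈ Finset.range N, 0 ≤ (-1) ^ (N - 1) * σ *
      (D.eval (y i) / ∏ j ∈ (Finset.range N).erase i, (y i - y j)) := by
    intro i hi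
    rw [Finset.mem_range] at hi
    have h1 := hw i hi
    have h2 := hs i hi
    have h3 : (-1 : ℝ) ^ (N - 1) = (-1) ^ i * (-1) ^ (N - 1 - i) := by
      rw [← pow_add]; congr 1; omega
    have h4 : (-1 : ℝ) ^ (N - 1 - i) * (-1) ^ (N - 1 - i) = 1 := by
      rw [← pow_add, ← two_mul, pow_mul]; norm_num
    set w := ∏ j ∈ (Finset.range N).erase i, (y i - y j) with hw'
    have hw0 : w ≠ 0 := fun h => by rw [h] at h1; simp at h1
    have h5 : (-1 : ℝ) ^ (N - 1) * σ * (D.eval (y i) / w) =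
        ((-1) ^ i * σ * D.eval (y i)) / ((-1) ^ (N - 1 - i) * w) := by
      rw [h3, eq_div_iff h1.ne']
      have h6 : D.eval (y i) / w * w = D.eval (y i) := div_mul_cancel₀ _ hw0
      linear_combination (-1 : ℝ) ^ i * σ * D.eval (y i) * h4 +
        (-1 : ℝ) ^ i * σ * (-1 : ℝ) ^ (N - 1 - i) * (-1 : ℝ) ^ (N - 1 - i) * h6
    rw [h5]
    exact div_nonneg h2 h1.le
  have hzero := (Finset.sum_eq_zero_iff_of_nonneg hterm).1 (by
    rw [← Finset.mul_sum, ← hsum, mul_zero])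
  refine Polynomial.eq_zero_of_degree_lt_of_eval_index_eq_zero (s := Finset.range N) hinj
    hdeg fun i hi => ?_
  have h1 := hzero i hi
  have h2 := hw i (Finset.mem_range.1 hi)
  have h3 : (∏ j ∈ (Finset.range N).erase i, (y i - y j)) ≠ 0 :=
    fun h => by rw [h] at h2; simp at h2
  simpa [hσ, h3] using h1

lemma abs_sub_le_deviation (a : ℝ) (P : ℝ[X]) {t : ℝ} (ht : t ∈ twoIntervals a) :
    |(|t|) - P.eval t| ≤ deviation a P := by
  refine le_csSup ?_ (mem_image_of_mem _ ht)
  refine (IsCompact.image_of_continuousOn (isCompact_Icc.union isCompact_Icc) ?_).bddAbove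
  fun_prop

namespace Equioscillates

variable {m : ℕ} {a L : ℝ} {Q : ℝ[X]} {x : ℕ → ℝ}

lemma node_lt_of_lt (h : Equioscillates m a L Q x) {i j : ℕ} (hij : i < j) (hj : j ≤ m + 1) :
    x i < x j := by
  induction j, hij using Nat.le_induction with
  | base => exact h.node_lt i (by omega)
  | succ j hj ih => exact (ih (by omega)).trans (h.node_lt j (by omega))

lemma node_mem (h : Equioscillates m a L Q x) {j : ℕ} (hj : j ≤ m + 1) : x j ∈ Icc a 1 := by
  constructor
  · rw [← h.node_zero]
    rcases Nat.eq_zero_or_pos j with rfl | hj0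
    · exact le_rfl
    · exact (h.node_lt_of_lt hj0 hj).le
  · rw [← h.node_last]
    rcases hj.eq_or_lt with rfl | hj0
    · exact le_rfl
    · exact (h.node_lt_of_lt hj0 le_rfl).le

/-- An equioscillating even polynomial is the only polynomial of degree at most `2m` with
deviation at most `L`. -/
lemma eq_of_deviation_le (h : Equioscillates m a L Q x) (ha0 : 0 < a) {P : ℝ[X]}
    (hP : P.natDegree ≤ 2 * m) (hle : ∀ t ∈ twoIntervals a, |(|t|) - P.eval t| ≤ L) :
    P = Q.comp (X ^ 2) := by
  have hpos : ∀ j ≤ m + 1, 0 < x j := fun j hj => ha0.trans_le (h.node_mem hj).1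
  have hdeg : (Q.comp (X ^ 2)).natDegree ≤ 2 * m := by
    rw [natDegree_comp, natDegree_X_pow]
    have := h.natDegree_le
    omega
  -- The points `-x (m + 1), …, -x 1, x 0, …, x (m + 1)`. The point `-x 0` is left out because the
  -- even error has the same sign at `±x 0`, which would break the alternation.
  let y : ℕ → ℝ := fun k => if k ≤ m then -x (m + 1 - k) else x (k - (m + 1))
  have hD : P - Q.comp (X ^ 2) = 0 := by
    refine eq_zero_of_weakly_alternating (n := 2 * m) (N := 2 * m + 3) (y := y)
      (σ := (-1) ^ (m)) ((natDegree_sub_le _ _).trans (max_le hP hdeg)) (by omega) ?_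
      (pow_ne_zero _ (by norm_num)) ?_
    · intro i j hij hj
      simp only [y]
      split_ifs with h1 h2 h2
      · exact neg_lt_neg (h.node_lt_of_lt (by omega) (by omega))
      · linarith [hpos (m + 1 - i) (by omega), hpos (j - (m + 1)) (by omega)]
      · omega
      · exact h.node_lt_of_lt (by omega) (by omega)
    · have key : ∀ j ≤ m + 1, ∀ t, |t| = x j → t ∈ twoIntervals a →
          0 ≤ (-1) ^ (j + 1) * (P - Q.comp (X ^ 2)).eval t := by
        intro j hj t ht htm
        have h1 := hle t htm
        have h2 := h.value j hj
        have h3 : t ^ 2 = x j ^ 2 := by rw [← ht, sq_abs]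
        rw [ht, _root_.abs_le] at h1
        simp only [eval_sub, eval_comp, eval_pow, eval_X, h3]
        rcases neg_one_pow_eq_or ℝ j with h4 | h4 <;> rw [pow_succ, h4] <;> rw [h4] at h2 <;>
          linarith [h1.1, h1.2]
      intro k hk
      by_cases hkm : k ≤ m
      · have hy : y k = -x (m + 1 - k) := by simp only [y, hkm, if_true]
        have h5 := h.node_mem (j := m + 1 - k) (by omega)
        have h6 := key (m + 1 - k) (by omega) (y k)
          (by rw [hy, abs_neg, abs_of_pos (hpos _ (by omega))])
          (by rw [hy]; left; constructor <;> linarith [h5.1, h5.2])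
        have h7 : (-1 : ℝ) ^ k * (-1) ^ m = (-1) ^ (m + 1 - k + 1) := by
          rw [← pow_add]
          refine neg_one_pow_congr ?_
          rw [show m + 1 - k + 1 = m - k + 2 by omega]
          simp only [Nat.even_add, Nat.even_sub hkm, even_two]; tauto
        rwa [h7]
      · have hy : y k = x (k - (m + 1)) := by simp only [y, hkm, if_false]
        have h5 := h.node_mem (j := k - (m + 1)) (by omega)
        have h6 := key (k - (m + 1)) (by omega) (y k)
          (by rw [hy, abs_of_pos (hpos _ (by omega))])
          (by rw [hy]; right; exact h5)
        have h7 : (-1 : ℝ) ^ k * (-1) ^ m = (-1) ^ (k - (m + 1) + 1) := by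
          rw [← pow_add]
          refine neg_one_pow_congr ?_
          rw [show k - (m + 1) + 1 = k - m by omega]
          rw [Nat.even_add, Nat.even_sub (by omega)]
        rwa [h7]
  exact sub_eq_zero.1 hD

lemma isBestApprox_iff (h : Equioscillates m a L Q x) (ha0 : 0 < a) (ha1 : a < 1) :
    approxError m a = L ∧ ∀ P : ℝ[X], IsBestApprox m a P ↔ P = Q.comp (X ^ 2) := by
  have hdeg : (Q.comp (X ^ 2)).natDegree ≤ 2 * m := by
    rw [natDegree_comp, natDegree_X_pow]
    have := h.natDegree_le
    omega
  have hle : ∀ t ∈ twoIntervals a, |(|t|) - (Q.comp (X ^ 2)).eval t| ≤ L := by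
    intro t ht
    have h1 : |t| ∈ Icc a 1 := by
      rcases ht with ht | ht
      · rw [abs_of_nonpos (by linarith [ht.2])]; constructor <;> linarith [ht.1, ht.2]
      · rwa [abs_of_nonneg (by linarith [ht.1])]
    have h2 := h.abs_le _ h1
    rw [abs_sub_comm] at h2
    simpa using h2
  have ha : a ∈ twoIntervals a := Or.inr ⟨le_rfl, ha1.le⟩
  have hdev : deviation a (Q.comp (X ^ 2)) = L := by
    refine le_antisymm (csSup_le ⟨_, mem_image_of_mem _ ha⟩ ?_) ?_
    · rintro _ ⟨t, ht, rfl⟩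
      exact hle t ht
    · have h1 := abs_sub_le_deviation a (Q.comp (X ^ 2)) ha
      have h2 := h.value 0 (by omega)
      rw [h.node_zero] at h2
      rw [abs_of_pos ha0, abs_sub_comm] at h1
      simp only [eval_comp, eval_pow, eval_X, h2] at h1
      simpa [abs_of_pos h.error_pos] using h1
  have heq : ∀ P : ℝ[X], P.natDegree ≤ 2 * m → deviation a P ≤ L → P = Q.comp (X ^ 2) :=
    fun P hP hPL => h.eq_of_deviation_le ha0 hP
      fun t ht => (abs_sub_le_deviation a P ht).trans hPL
  have herr : approxError m a = L := by
    refine IsLeast.csInf_eq ⟨⟨_, hdeg, hdev⟩, ?_⟩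
    rintro _ ⟨P, hP, rfl⟩
    by_contra hlt
    push Not at hlt
    have := heq P hP hlt.le
    rw [this, hdev] at hlt
    exact lt_irrefl _ hlt
  refine ⟨herr, fun P => ⟨fun hP => heq P hP.1 (hP.2.trans herr).le, ?_⟩⟩
  rintro rfl
  exact ⟨hdeg, hdev.trans herr.symm⟩

end Equioscillates

/-! ### The quadrant and a Phragmén–Lindelöf principle -/

lemma openQuadrant_eq : openQuadrant = Ioi 0 ×ℂ Ioi 0 := rfl

lemma closedQuadrant_eq : closedQuadrant = Ici 0 ×ℂ Ici 0 := rfl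

lemma isOpen_openQuadrant : IsOpen openQuadrant := isOpen_Ioi.reProdIm isOpen_Ioi

lemma isClosed_closedQuadrant : IsClosed closedQuadrant := isClosed_Ici.reProdIm isClosed_Ici

lemma closure_openQuadrant : closure openQuadrant = closedQuadrant := by
  rw [openQuadrant_eq, Complex.closure_reProdIm, closure_Ioi, closedQuadrant_eq]

lemma openQuadrant_subset : openQuadrant ⊆ closedQuadrant := fun _ hz => ⟨hz.1.le, hz.2.le⟩

lemma convex_openQuadrant : Convex ℝ openQuadrant :=
  (convex_halfSpace_re_gt 0).inter (convex_halfSpace_im_gt 0)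

lemma convex_closedQuadrant : Convex ℝ closedQuadrant :=
  (convex_halfSpace_re_ge 0).inter (convex_halfSpace_im_ge 0)

lemma isPreconnected_openQuadrant : IsPreconnected openQuadrant :=
  convex_openQuadrant.isPreconnected

lemma ofReal_mem_closedQuadrant {x : ℝ} (hx : 0 ≤ x) : (x : ℂ) ∈ closedQuadrant := by
  simp [closedQuadrant, hx]

lemma ofReal_mul_I_mem_closedQuadrant {y : ℝ} (hy : 0 ≤ y) :
    (y : ℂ) * Complex.I ∈ closedQuadrant := by
  simp [closedQuadrant, hy]

/-- A function on the quadrant whose real part is bounded below and nonnegative on the boundary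
has positive real part inside, unless this real part vanishes identically. -/
lemma re_pos_of_nonneg_on_boundary {f : ℂ → ℂ} (hd : DifferentiableOn ℂ f openQuadrant)
    (hc : ContinuousOn f closedQuadrant) {C : ℝ} (hC : ∀ z ∈ openQuadrant, -C ≤ (f z).re)
    (hre : ∀ x : ℝ, 0 ≤ x → 0 ≤ (f x).re) (him : ∀ y : ℝ, 0 ≤ y → 0 ≤ (f (y * Complex.I)).re)
    {z₀ : ℂ} (hz₀ : z₀ ∈ closedQuadrant) (hpos : 0 < (f z₀).re) :
    ∀ z ∈ openQuadrant, 0 < (f z).re := by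
  -- The lower bound on `Re f` makes `g` bounded, so Phragmén–Lindelöf gives `|g| ≤ 1`. If `|g|`
  -- reached `1` inside, `g` would be constant, contradicting `|g z₀| < 1`.
  set g : ℂ → ℂ := fun z => Complex.exp (-f z) with hg
  have hnorm : ∀ z, ‖g z‖ = Real.exp (-(f z).re) := fun z => by simp [hg, Complex.norm_exp]
  have hgd : DifferentiableOn ℂ g openQuadrant := hd.neg.cexp
  have hgc : ContinuousOn g closedQuadrant := hc.neg.cexp
  have hle : ∀ z ∈ closedQuadrant, ‖g z‖ ≤ 1 := by
    intro z hz
    refine PhragmenLindelof.quadrant_I (f := g) (C := 1) ?_ ?_ ?_ ?_ hz.1 hz.2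
    · rw [← openQuadrant_eq]
      exact ⟨hgd, by rw [closure_openQuadrant]; exact hgc⟩
    · refine ⟨1, by norm_num, 0, ?_⟩
      simp only [zero_mul, Real.exp_zero]
      refine Asymptotics.IsBigO.of_bound (Real.exp C) ?_
      rw [← openQuadrant_eq]
      filter_upwards [mem_inf_of_right (mem_principal_self openQuadrant)] with z hz
      rw [hnorm]
      simpa using neg_le.1 (hC z hz)
    · intro x hx
      rw [hnorm]; simpa using hre x hx
    · intro x hx
      rw [hnorm]; simpa using him x hx
  intro z hz
  by_contra hneg
  push Not at hneg
  have hz1 : 1 ≤ ‖g z‖ := by rw [hnorm]; simpa using hneg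
  have hmax : IsMaxOn (norm ∘ g) openQuadrant z := fun w hw =>
    (hle w (openQuadrant_subset hw)).trans hz1
  have heq := Complex.eqOn_of_isPreconnected_of_isMaxOn_norm isPreconnected_openQuadrant
    isOpen_openQuadrant hgd hz hmax
  have heq' : EqOn g (Function.const ℂ (g z)) closedQuadrant :=
    heq.of_subset_closure hgc continuousOn_const openQuadrant_subset closure_openQuadrant.ge
  have h1 := heq' hz₀
  have h2 : ‖g z₀‖ < 1 := by rw [hnorm]; simpa using hpos
  rw [h1] at h2
  exact absurd hz1 (not_le.2 h2)

/-! ### Square roots, logarithms and the arccosine on the quadrant -/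

/-- `F` has a square root on the quadrant that is continuous up to the boundary and whose logarithm
has bounded imaginary part. -/
def HasQuadrantSqrt (F : ℂ → ℂ) : Prop :=
  ∃ (f g : ℂ → ℂ) (C : ℝ), ContinuousOn f closedQuadrant ∧ DifferentiableOn ℂ f openQuadrant ∧
    (∀ z ∈ closedQuadrant, f z ^ 2 = F z) ∧ ContinuousOn g openQuadrant ∧
    (∀ z ∈ openQuadrant, Complex.exp (g z) = f z) ∧ ∀ z ∈ openQuadrant, |(g z).im| ≤ C

lemma HasQuadrantSqrt.mul {F G : ℂ → ℂ} (hF : HasQuadrantSqrt F) (hG : HasQuadrantSqrt G) :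
    HasQuadrantSqrt fun z => F z * G z := by
  obtain ⟨f, g, C, h1, h2, h3, h4, h5, h6⟩ := hF
  obtain ⟨f', g', C', h1', h2', h3', h4', h5', h6'⟩ := hG
  refine ⟨fun z => f z * f' z, fun z => g z + g' z, C + C', h1.mul h1', h2.mul h2', ?_,
    h4.add h4', ?_, ?_⟩
  · intro z hz; rw [mul_pow, h3 z hz, h3' z hz]
  · intro z hz; rw [Complex.exp_add, h5 z hz, h5' z hz]
  · intro z hz
    rw [Complex.add_im]
    exact (abs_add_le _ _).trans (add_le_add (h6 z hz) (h6' z hz))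

lemma hasQuadrantSqrt_const {c : ℂ} (hc : c ≠ 0) : HasQuadrantSqrt fun _ => c := by
  refine ⟨fun _ => Complex.exp (Complex.log c / 2), fun _ => Complex.log c / 2, _,
    continuousOn_const, differentiableOn_const _, ?_, continuousOn_const, fun _ _ => rfl,
    fun z _ => le_rfl⟩
  intro z _
  rw [← Complex.exp_nat_mul]
  push_cast
  rw [mul_div_cancel₀ _ two_ne_zero, Complex.exp_log hc]

/-- The principal root works. It remains continuous where `κ (z - r)` vanishes, so zeros on the
boundary of the quadrant are allowed. -/
lemma hasQuadrantSqrt_of_re_pos {κ r : ℂ} (h0 : ∀ z ∈ openQuadrant, 0 < (κ * (z - r)).re)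
    (h1 : ∀ z ∈ closedQuadrant, 0 ≤ (κ * (z - r)).re) :
    HasQuadrantSqrt fun z => κ * (z - r) := by
  refine ⟨fun z => (κ * (z - r)) ^ (1 / 2 : ℂ), fun z => Complex.log (κ * (z - r)) * (1 / 2),
    Real.pi, ?_, ?_, ?_, ?_, ?_, ?_⟩
  · intro z hz
    have := Complex.continuousAt_cpow_const_of_re_pos (z := κ * (z - r)) (w := (1 / 2 : ℂ))
      (Or.inl (h1 z hz)) (by norm_num)
    exact (ContinuousAt.comp (f := fun z => κ * (z - r)) this (by fun_prop)).continuousWithinAt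
  · intro z hz
    refine (DifferentiableAt.cpow_const (by fun_prop) ?_).differentiableWithinAt
    exact Or.inl (h0 z hz)
  · intro z hz
    rw [← Complex.cpow_nat_mul]
    norm_num
  · refine ContinuousOn.mul (ContinuousOn.clog (by fun_prop) fun z hz => Or.inl (h0 z hz))
      continuousOn_const
  · intro z hz
    beta_reduce
    rw [Complex.cpow_def_of_ne_zero]
    intro h
    have := h0 z hz
    rw [h] at this
    simp at this
  · intro z hz
    have h2 : (Complex.log (κ * (z - r)) * (1 / 2)).im = Complex.arg (κ * (z - r)) / 2 := by
      rw [show (1 / 2 : ℂ) = ((1 / 2 : ℝ) : ℂ) by norm_num, Complex.im_mul_ofReal, Complex.log_im]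
      ring
    rw [h2, abs_div, abs_of_pos (by norm_num : (0 : ℝ) < 2)]
    linarith [Complex.abs_arg_le_pi (κ * (z - r)), abs_nonneg (Complex.arg (κ * (z - r)))]

/-- Either `Re r ≤ 0`, and `z - r` lies in the right half-plane, or `Im r ≤ 0`, and the rotation by
`-i` brings it there. -/
lemma hasQuadrantSqrt_sub {r : ℂ} (hr : r ∉ openQuadrant) : HasQuadrantSqrt fun z => z - r := by
  by_cases h : r.re ≤ 0
  · have := hasQuadrantSqrt_of_re_pos (κ := 1) (r := r)
      (fun z hz => by simp; linarith [hz.1]) (fun z hz => by simp; linarith [hz.1])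
    simpa using this
  · have h2 : r.im ≤ 0 := by
      by_contra h2
      exact hr ⟨not_le.1 h, not_le.1 h2⟩
    have := (hasQuadrantSqrt_const (c := Complex.I) Complex.I_ne_zero).mul
      (hasQuadrantSqrt_of_re_pos (κ := -Complex.I) (r := r)
      (fun z hz => by simp; linarith [hz.2]) (fun z hz => by simp; linarith [hz.2]))
    simpa [← mul_assoc] using this

lemma hasQuadrantSqrt_eval {F : ℂ[X]} (hF : F ≠ 0) (h0 : ∀ z ∈ openQuadrant, F.eval z ≠ 0) :
    HasQuadrantSqrt fun z => F.eval z := by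
  have key : ∀ s : Multiset ℂ, (∀ r ∈ s, r ∉ openQuadrant) →
      HasQuadrantSqrt fun z => (s.map fun r => z - r).prod := by
    intro s
    induction s using Multiset.induction_on with
    | empty => intro _; simpa using hasQuadrantSqrt_const one_ne_zero
    | cons r s ih =>
      intro hs
      have := (hasQuadrantSqrt_sub (hs r (Multiset.mem_cons_self r s))).mul
        (ih fun q hq => hs q (Multiset.mem_cons_of_mem hq))
      simpa using this
  have h1 := (hasQuadrantSqrt_const (leadingCoeff_ne_zero.2 hF)).mul
    (key F.roots fun r hr hrQ => h0 r hrQ ((mem_roots hF).1 hr))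
  have h2 : ∀ z, F.eval z = F.leadingCoeff * (F.roots.map fun r => z - r).prod := by
    intro z
    conv_lhs => rw [(IsAlgClosed.splits F).eq_prod_roots]
    simp [eval_mul, eval_multiset_prod, Multiset.map_map]
  simpa only [h2] using h1

/-- A nonvanishing continuous function on the closed quadrant has a continuous logarithm. -/
lemma exists_log_on_closedQuadrant {J : ℂ → ℂ} (hJ : ContinuousOn J closedQuadrant)
    (h0 : ∀ z ∈ closedQuadrant, J z ≠ 0) :
    ∃ ℓ : ℂ → ℂ, ContinuousOn ℓ closedQuadrant ∧ ∀ z ∈ closedQuadrant, Complex.exp (ℓ z) = J z := by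
  have hmem : (0 : ℂ) ∈ closedQuadrant := ⟨le_rfl, le_rfl⟩
  have : ContractibleSpace closedQuadrant := convex_closedQuadrant.contractibleSpace ⟨0, hmem⟩
  have : LocallyPathConnectedSpace closedQuadrant :=
    convex_closedQuadrant.locallyPathConnectedSpace
  obtain ⟨F, ⟨-, hF⟩, -⟩ := Complex.isCoveringMapOn_exp.existsUnique_continuousMap_lifts
    (A := closedQuadrant) ⟨closedQuadrant.domRestrict J, hJ.domRestrict⟩ (a₀ := ⟨0, hmem⟩)
    (e₀ := Complex.log (J 0)) (Complex.exp_log (h0 0 hmem)) (fun z => h0 z z.2)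
  classical
  refine ⟨fun z => if h : z ∈ closedQuadrant then F ⟨z, h⟩ else 0, ?_, ?_⟩
  · rw [continuousOn_iff_continuous_domRestrict]
    convert F.continuous using 1
    ext z
    simp
  · intro z hz
    simp only [hz, dif_pos]
    exact congrFun hF ⟨z, hz⟩

/-- Near `z₀` continuity keeps the imaginary part within `π` of its value there, so `ℓ = ℓ(z₀) +
log(J / J(z₀))` with the principal logarithm. -/
lemma differentiableOn_of_exp_eq {s : Set ℂ} (hs : IsOpen s) {ℓ J : ℂ → ℂ} (hℓ : ContinuousOn ℓ s)
    (hJ : DifferentiableOn ℂ J s) (h : ∀ z ∈ s, Complex.exp (ℓ z) = J z) :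
    DifferentiableOn ℂ ℓ s := by
  intro z₀ hz₀
  have hnhds := hs.mem_nhds hz₀
  have hJ0 : J z₀ ≠ 0 := by rw [← h z₀ hz₀]; exact Complex.exp_ne_zero _
  have hcont : ContinuousAt (fun z => (ℓ z - ℓ z₀).im) z₀ :=
    Complex.continuous_im.continuousAt.comp ((hℓ.continuousAt hnhds).sub continuousAt_const)
  have hev : ∀ᶠ z in 𝓝 z₀, ℓ z = ℓ z₀ + Complex.log (J z / J z₀) := by
    filter_upwards [hnhds, hcont.eventually_lt_const (u := Real.pi) (by simp [Real.pi_pos]),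
      hcont.eventually_const_lt (u := -Real.pi) (by simp [Real.pi_pos])] with z hz h1 h2
    rw [← h z hz, ← h z₀ hz₀, ← Complex.exp_sub, Complex.log_exp h2 h1.le]
    ring
  have hd : DifferentiableAt ℂ (fun z => ℓ z₀ + Complex.log (J z / J z₀)) z₀ := by
    refine (DifferentiableAt.clog ((hJ.differentiableAt hnhds).div_const _) ?_).const_add _
    rw [div_self hJ0]
    exact Complex.one_mem_slitPlane
  exact (hd.congr_of_eventuallyEq hev).differentiableWithinAt

lemma cos_mem_of_im_eq_zero {w : ℂ} (hw : w.im = 0) :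
    ∃ t : ℝ, t ∈ Icc (-1) 1 ∧ Complex.cos w = t := by
  refine ⟨Real.cos w.re, ⟨Real.neg_one_le_cos _, Real.cos_le_one _⟩, ?_⟩
  rw [Complex.ofReal_cos]
  congr 1
  exact Complex.ext (by simp) (by simp [hw])

/-- A branch of `arccos R` on the quadrant, for a polynomial `R` that omits `[-1, 1]` there. -/
lemma exists_arccos_branch {R : ℂ[X]}
    (hR : ∀ z ∈ openQuadrant, ∀ t : ℝ, t ∈ Icc (-1) 1 → R.eval z ≠ t) {a : ℝ} (ha : 0 ≤ a)
    (hRa : R.eval (a : ℂ) = 1) :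
    ∃ (φ : ℂ → ℂ) (C : ℝ), ContinuousOn φ closedQuadrant ∧ DifferentiableOn ℂ φ openQuadrant ∧
      (∀ z ∈ closedQuadrant, Complex.cos (φ z) = R.eval z) ∧ (∀ z ∈ openQuadrant, 0 < (φ z).im) ∧
      (∀ z ∈ openQuadrant, |(φ z).re| ≤ C) ∧ φ a = 0 := by
  have hne : ∀ z ∈ openQuadrant, (R ^ 2 - 1).eval z ≠ 0 := by
    intro z hz h
    have h1 : (R.eval z - 1) * (R.eval z + 1) = 0 := by
      simp only [eval_sub, eval_pow, eval_one] at h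
      linear_combination h
    rcases mul_eq_zero.1 h1 with h2 | h2
    · exact hR z hz 1 (by norm_num) (by push_cast; linear_combination h2)
    · exact hR z hz (-1) (by norm_num) (by push_cast; linear_combination h2)
  have hz1 : (1 + Complex.I) ∈ openQuadrant := by simp [openQuadrant]
  obtain ⟨s, g, C, hsc, hsd, hs2, hgc, hgs, hgC⟩ := hasQuadrantSqrt_eval (F := R ^ 2 - 1)
    (fun h => hne _ hz1 (by rw [h]; simp)) hne
  simp only [eval_sub, eval_pow, eval_one] at hs2
  -- Inverse Joukowski map: with `s² = R² - 1`, the function `R + s` never vanishes, even on the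
  -- boundary, and `i log(R + s)` is an arccosine of `R`.
  have hJinv : ∀ z ∈ closedQuadrant, (R.eval z + s z) * (R.eval z - s z) = 1 := by
    intro z hz; linear_combination -hs2 z hz
  obtain ⟨ℓ, hℓc, hℓ⟩ := exists_log_on_closedQuadrant (J := fun z => R.eval z + s z)
    (R.continuous.continuousOn.add hsc)
    (fun z hz h => by have := hJinv z hz; rw [h] at this; simp at this)
  have hℓd := differentiableOn_of_exp_eq isOpen_openQuadrant (hℓc.mono openQuadrant_subset)
    (R.differentiable.differentiableOn.add hsd) (fun z hz => hℓ z (openQuadrant_subset hz))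
  have hcosℓ : ∀ z ∈ closedQuadrant, Complex.cos (Complex.I * ℓ z) = R.eval z := by
    intro z hz
    have h1 : Complex.exp (-ℓ z) = R.eval z - s z := by
      rw [Complex.exp_neg, hℓ z hz]
      exact inv_eq_of_mul_eq_one_right (hJinv z hz)
    have h2 : Complex.I * ℓ z * Complex.I = - ℓ z := by
      linear_combination ℓ z * Complex.I_mul_I
    rw [Complex.cos, neg_mul, h2, neg_neg, hℓ z hz, h1]
    ring
  have hbranch : ∃ φ : ℂ → ℂ, ContinuousOn φ closedQuadrant ∧
      DifferentiableOn ℂ φ openQuadrant ∧ (∀ z ∈ closedQuadrant, Complex.cos (φ z) = R.eval z) ∧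
      (∀ z ∈ openQuadrant, 0 < (φ z).im) := by
    -- A real arccosine would put `R z` in `[-1, 1]`. The imaginary part therefore has one sign,
    -- which is made positive by the evenness of the cosine.
    have him : ∀ z ∈ openQuadrant, (Complex.I * ℓ z).im ≠ 0 := by
      intro z hz h
      obtain ⟨t, ht, hcos⟩ := cos_mem_of_im_eq_zero h
      rw [hcosℓ z (openQuadrant_subset hz)] at hcos
      exact hR z hz t ht hcos
    have hcon : ContinuousOn (fun z => (Complex.I * ℓ z).im) openQuadrant :=
      Complex.continuous_im.comp_continuousOn
        (continuousOn_const.mul (hℓc.mono openQuadrant_subset))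
    by_cases hsgn : 0 < (Complex.I * ℓ (1 + Complex.I)).im
    · refine ⟨fun z => Complex.I * ℓ z, continuousOn_const.mul hℓc,
        (differentiableOn_const _).mul hℓd, hcosℓ, fun z hz => ?_⟩
      by_contra hneg
      obtain ⟨w, hw, hw0⟩ := isPreconnected_openQuadrant.intermediate_value hz hz1 hcon
        (show (0 : ℝ) ∈ Icc _ _ from ⟨not_lt.1 hneg, hsgn.le⟩)
      exact him w hw hw0
    · refine ⟨fun z => -(Complex.I * ℓ z), (continuousOn_const.mul hℓc).neg,
        ((differentiableOn_const _).mul hℓd).neg,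
        fun z hz => by rw [Complex.cos_neg, hcosℓ z hz], fun z hz => ?_⟩
      by_contra hneg
      rw [Complex.neg_im] at hneg
      obtain ⟨w, hw, hw0⟩ := isPreconnected_openQuadrant.intermediate_value hz1 hz hcon
        (show (0 : ℝ) ∈ Icc _ _ from ⟨not_lt.1 hsgn, by linarith⟩)
      exact him w hw hw0
  obtain ⟨φ, hφc, hφd, hφcos, hφim⟩ := hbranch
  set E : ℂ → ℂ := fun z => Complex.exp (2 * Complex.I * φ z) with hE
  have hEnorm : ∀ z ∈ openQuadrant, ‖E z‖ < 1 := by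
    intro z hz
    rw [hE, Complex.norm_exp]
    simp
    exact hφim z hz
  have hre : ∀ z ∈ openQuadrant, 0 < (1 - E z).re := by
    intro z hz
    have := (Complex.abs_re_le_norm (E z)).trans_lt (hEnorm z hz)
    rw [abs_lt] at this
    simp; linarith [this.2]
  -- This bounds `Re φ`. Since `R² - 1 = -sin² φ = exp(-2iφ)(1 - E)²/4`, the combination `D` is a
  -- logarithm of `1`, hence constant. In its imaginary part every term besides `-2 Re φ` is
  -- bounded.
  set D : ℂ → ℂ := fun z =>
    -2 * Complex.I * φ z + 2 * Complex.log (1 - E z) - 2 * g z - Complex.log 4 with hDdef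
  have hφco := hφc.mono openQuadrant_subset
  have hDc : ContinuousOn D openQuadrant := by
    have hEc : ContinuousOn (fun z => Complex.log (1 - E z)) openQuadrant := by
      refine ContinuousOn.clog ?_ fun z hz => Or.inl (hre z hz)
      exact continuousOn_const.sub (continuousOn_const.mul hφco).cexp
    exact (((continuousOn_const.mul hφco).add (continuousOn_const.mul hEc)).sub
      (continuousOn_const.mul hgc)).sub continuousOn_const
  have hD1 : ∀ z ∈ openQuadrant, Complex.exp (D z) = 1 := by
    intro z hz
    have hz' := openQuadrant_subset hz
    have h1 : 1 - E z ≠ 0 := fun h => by have := hre z hz; rw [h] at this; simp at this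
    have hcos := hφcos z hz'
    rw [Complex.cos] at hcos
    have hE2 : E z = Complex.exp (φ z * Complex.I) ^ 2 := by
      change Complex.exp (2 * Complex.I * φ z) = _
      rw [← Complex.exp_nat_mul]; congr 1; push_cast; ring
    have hX : Complex.exp (-2 * Complex.I * φ z) = Complex.exp (-φ z * Complex.I) ^ 2 := by
      rw [← Complex.exp_nat_mul]; congr 1; push_cast; ring
    have hmul : Complex.exp (φ z * Complex.I) * Complex.exp (-φ z * Complex.I) = 1 := by
      rw [← Complex.exp_add]; simp
    have hl : Complex.exp (2 * Complex.log (1 - E z)) = (1 - E z) ^ 2 := by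
      rw [show (2 : ℂ) * Complex.log (1 - E z) = ((2 : ℕ) : ℂ) * Complex.log (1 - E z) by
        push_cast; ring, Complex.exp_nat_mul, Complex.exp_log h1]
    have hg2 : Complex.exp (2 * g z) = R.eval z ^ 2 - 1 := by
      rw [show (2 : ℂ) * g z = ((2 : ℕ) : ℂ) * g z by push_cast; ring, Complex.exp_nat_mul,
        hgs z hz, hs2 z hz']
    have hne' : R.eval z ^ 2 - 1 ≠ 0 := by
      have := hne z hz; simpa using this
    rw [hDdef]
    simp only
    rw [Complex.exp_sub, Complex.exp_sub, Complex.exp_add, hX, hl, hg2,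
      Complex.exp_log (by norm_num : (4 : ℂ) ≠ 0), div_div, div_eq_one_iff_eq (by
        exact mul_ne_zero hne' (by norm_num)), hE2, ← hcos]
    set p := Complex.exp (φ z * Complex.I)
    set q := Complex.exp (-φ z * Complex.I)
    linear_combination (-2 * (p * q + 2) + p ^ 2 * (p * q + 1)) * hmul
  have hmaps : MapsTo D openQuadrant
      (AddSubgroup.zmultiples (2 * Real.pi * Complex.I) : Set ℂ) := by
    intro z hz
    obtain ⟨n, hn⟩ := Complex.exp_eq_one_iff.1 (hD1 z hz)
    exact ⟨n, by simp [hn]⟩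
  obtain ⟨y, -, hy⟩ := isPreconnected_openQuadrant.eqOn_const_of_mapsTo
    ⟨NormedSpace.discreteTopology_zmultiples _⟩ hDc hmaps ⟨0, zero_mem _⟩
  have hbound : ∀ z ∈ openQuadrant, |(φ z).re| ≤ Real.pi + C + |(Complex.log 4).im| + |y.im| := by
    intro z hz
    have h1 := congrArg Complex.im (hy hz)
    simp [hDdef] at h1
    have h2 : |(Complex.log (1 - E z)).im| ≤ Real.pi := by
      rw [Complex.log_im]; exact Complex.abs_arg_le_pi _
    rw [abs_le] at h2
    have h3 := abs_le.1 (hgC z hz)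
    have h4 := neg_abs_le (Complex.log 4).im
    have h4' := le_abs_self (Complex.log 4).im
    have h5 := neg_abs_le y.im
    have h5' := le_abs_self y.im
    rw [abs_le]
    constructor <;> linarith [h2.1, h2.2, h3.1, h3.2]
  have hφa : Complex.cos (φ a) = 1 := by rw [hφcos a (ofReal_mem_closedQuadrant ha), hRa]
  obtain ⟨n, hn⟩ := Complex.cos_eq_one_iff.1 hφa
  refine ⟨fun z => φ z - φ a, Real.pi + C + |(Complex.log 4).im| + |y.im| + |(φ a).re|,
    hφc.sub continuousOn_const, hφd.sub (differentiableOn_const _), ?_, ?_, ?_, sub_self _⟩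
  · intro z hz
    rw [← hφcos z hz, ← hn, Complex.cos_sub_int_mul_two_pi]
  · intro z hz
    have : (φ a).im = 0 := by
      rw [← hn]; simp
    simpa [this] using hφim z hz
  · intro z hz
    rw [Complex.sub_re]
    have := abs_sub (φ z).re (φ a).re
    linarith [hbound z hz]

/-! ### Values omitted by `Q(z²) - z` in the quadrant -/

lemma norm_aeval_le (S : ℝ[X]) {n : ℕ} (hS : S.natDegree ≤ n) :
    ∃ A : ℝ, 0 ≤ A ∧ ∀ z : ℂ, ‖aeval z S‖ ≤ A * (1 + ‖z‖) ^ n := by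
  refine ⟨∑ k ∈ Finset.range (n + 1), |S.coeff k|, Finset.sum_nonneg fun _ _ => abs_nonneg _,
    fun z => ?_⟩
  rw [aeval_eq_sum_range' (Nat.lt_succ_of_le hS), Finset.sum_mul]
  refine (norm_sum_le _ _).trans (Finset.sum_le_sum fun k hk => ?_)
  rw [norm_smul, norm_pow, Real.norm_eq_abs]
  refine mul_le_mul_of_nonneg_left ?_ (abs_nonneg _)
  calc ‖z‖ ^ k ≤ (1 + ‖z‖) ^ k := pow_le_pow_left₀ (norm_nonneg _) (by linarith) _
    _ ≤ (1 + ‖z‖) ^ n := pow_le_pow_right₀ (by linarith [norm_nonneg z])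
        (by have := Finset.mem_range.1 hk; omega)

lemma norm_add_ofReal_ge {a t : ℝ} (ha0 : 0 < a) (ha1 : a < 1) (hat : a ≤ t) {z : ℂ}
    (hz : z ∈ closedQuadrant) : a / 2 * (1 + ‖z‖) ≤ ‖z + t‖ := by
  have h1 : t ≤ ‖z + t‖ := by
    have := Complex.re_le_norm (z + t)
    simp at this
    linarith [hz.1]
  have h2 : ‖z‖ ≤ ‖z + t‖ := by
    rw [← sq_le_sq₀ (norm_nonneg _) (norm_nonneg _), Complex.sq_norm, Complex.sq_norm,
      Complex.normSq_apply, Complex.normSq_apply]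
    simp
    nlinarith [hz.1, mul_nonneg hz.1 (ha0.le.trans hat)]
  nlinarith [norm_nonneg z]

lemma aeval_ofReal_eq (S : ℝ[X]) (x : ℝ) : aeval (x : ℂ) S = ((S.eval x : ℝ) : ℂ) :=
  aeval_algebraMap_apply_eq_algebraMap_eval x S

lemma aeval_comp_sq (Q : ℝ[X]) (z : ℂ) : aeval z (Q.comp (X ^ 2)) = aeval (z ^ 2) Q := by
  simp [aeval_comp]

lemma aeval_sq_mul_I (Q : ℝ[X]) (y : ℝ) :
    aeval (((y : ℂ) * Complex.I) ^ 2) Q = ((Q.eval (-y ^ 2) : ℝ) : ℂ) := by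
  have : ((y : ℂ) * Complex.I) ^ 2 = ((-y ^ 2 : ℝ) : ℂ) := by
    rw [mul_pow, Complex.I_sq]
    push_cast; ring
  rw [this, aeval_ofReal_eq]

namespace Equioscillates

variable {m : ℕ} {a L : ℝ} {Q : ℝ[X]} {x : ℕ → ℝ}

/-- In the quadrant, `Q(z²) - z` omits the interval `(-L, L)`. -/
lemma aeval_sub_ne_of_abs_lt (h : Equioscillates m a L Q x) (ha0 : 0 < a) (ha1 : a < 1) {w : ℝ}
    (hw : |w| < L) {z : ℂ} (hz : z ∈ openQuadrant) : aeval (z ^ 2) Q - z ≠ w := by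
  rw [_root_.abs_lt] at hw
  have hcont : Continuous fun t => Q.eval (t ^ 2) - t := by fun_prop
  -- Equioscillation supplies one real solution in each of the `m + 1` gaps. The remaining factor
  -- `S` has no larger degree than their product.
  have hroot : ∀ j : Fin (m + 1), ∃ t ∈ Ioo (x j) (x (j + 1)), Q.eval (t ^ 2) - t = w := by
    intro j
    have hj : (j : ℕ) ≤ m := by omega
    have h1 := h.value j (by omega)
    have h2 := h.value (j + 1) (by omega)
    rcases neg_one_pow_eq_or ℝ j with h3 | h3
    · rw [h3] at h1
      rw [pow_succ (-1 : ℝ), h3] at h2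
      exact intermediate_value_Ioo' (h.node_lt j hj).le hcont.continuousOn
        ⟨by linarith [hw.1], by linarith [hw.2]⟩
    · rw [h3] at h1
      rw [pow_succ (-1 : ℝ), h3] at h2
      exact intermediate_value_Ioo (h.node_lt j hj).le hcont.continuousOn
        ⟨by linarith [hw.1], by linarith [hw.2]⟩
  choose t ht htw using hroot
  have hta : ∀ j, a ≤ t j := fun j => ((h.node_mem (by omega)).1.trans (ht j).1.le)
  have htmono : StrictMono t := by
    intro i j hij
    refine (ht i).2.trans_le (le_trans ?_ (ht j).1.le)
    rcases (show (i : ℕ) + 1 ≤ j from hij).eq_or_lt with h4 | h4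
    · rw [h4]
    · exact (h.node_lt_of_lt h4 (by omega)).le
  set F : ℝ[X] := Q.comp (X ^ 2) - X - C w with hF
  have hF0 : F ≠ 0 := by
    intro h0
    have h1 := congrArg (eval (x 0)) h0
    have h2 := h.value 0 (by omega)
    simp [hF] at h1 h2
    linarith [hw.2]
  have hdvd : (∏ j, (X - C (t j))) ∣ F := by
    refine Finset.prod_dvd_of_coprime
      (fun i _ j _ hij => pairwise_coprime_X_sub_C htmono.injective hij) fun j _ => ?_
    rw [dvd_iff_isRoot]
    simp [hF, htw j]
  obtain ⟨S, hS⟩ := hdvd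
  have hSdeg : S.natDegree ≤ m + 1 := by
    have h1 : F.natDegree ≤ 2 * m + 1 := by
      refine (natDegree_sub_le _ _).trans (max_le ((natDegree_sub_le _ _).trans (max_le ?_ ?_)) ?_)
      · rw [natDegree_comp, natDegree_X_pow]
        have := h.natDegree_le
        omega
      · rw [natDegree_X]; omega
      · rw [natDegree_C]; omega
    have h2 : (∏ j, (X - C (t j))).natDegree = m + 1 := by
      rw [natDegree_prod_of_monic _ _ fun j _ => monic_X_sub_C _]
      simp
    rw [hS, natDegree_mul (left_ne_zero_of_mul (hS ▸ hF0)) (right_ne_zero_of_mul (hS ▸ hF0)),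
      h2] at h1
    omega
  have hFz : ∀ z : ℂ, aeval (z ^ 2) Q - z - w = (∏ j, (z - t j)) * aeval z S := by
    intro z
    have h1 := congrArg (aeval z) hS
    simpa [hF, aeval_comp, map_prod] using h1
  have hden : ∀ z ∈ closedQuadrant, ∀ j, z + (t j : ℂ) ≠ 0 := by
    intro z hz j h0
    have h1 := norm_add_ofReal_ge ha0 ha1 (hta j) hz
    rw [h0, norm_zero] at h1
    nlinarith [norm_nonneg z]
  have hprod : ∀ z ∈ closedQuadrant, ∏ j, (z + (t j : ℂ)) ≠ 0 := fun z hz =>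
    Finset.prod_ne_zero_iff.2 fun j _ => hden z hz j
  -- The solutions are replaced by their reflections `-t j`, which keeps the denominator away from
  -- zero and `f` bounded. On the real axis `f` is imaginary. On the imaginary axis `(iy - t)(iy +
  -- t) = -(y² + t²)` yields the real part `y / ∏ (y² + t²)`. Hence `Re f > 0` inside, and `S` has
  -- no zero there.
  set f : ℂ → ℂ := fun z =>
    -Complex.I * (((-1) ^ m : ℝ) : ℂ) * (aeval z S / ∏ j, (z + (t j : ℂ))) with hf
  have hdiffS : Differentiable ℂ fun z : ℂ => aeval z S := S.differentiable_aeval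
  have hdiffP : Differentiable ℂ fun z : ℂ => ∏ j, (z + (t j : ℂ)) := by fun_prop
  have hfd : ∀ z ∈ closedQuadrant, DifferentiableAt ℂ f z := fun z hz =>
    (differentiableAt_const _).mul (hdiffS.differentiableAt.div hdiffP.differentiableAt (hprod z hz))
  obtain ⟨A, hA0, hA⟩ := norm_aeval_le S hSdeg
  have hbound : ∀ z ∈ openQuadrant, -(A / (a / 2) ^ (m + 1)) ≤ (f z).re := by
    intro z hz
    have hz' := openQuadrant_subset hz
    have h1 : (a / 2) ^ (m + 1) * (1 + ‖z‖) ^ (m + 1) ≤ ‖∏ j, (z + (t j : ℂ))‖ := by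
      rw [norm_prod, ← mul_pow]
      have : (a / 2 * (1 + ‖z‖)) ^ (m + 1) = ∏ j : Fin (m + 1), (a / 2 * (1 + ‖z‖)) := by simp
      rw [this]
      exact Finset.prod_le_prod (fun j _ => by positivity)
        fun j _ => norm_add_ofReal_ge ha0 ha1 (hta j) hz'
    have h2 : ‖f z‖ ≤ A / (a / 2) ^ (m + 1) := by
      rw [hf]
      simp only [norm_mul, norm_neg, Complex.norm_I, Complex.norm_real, norm_pow, norm_one, one_pow,
        one_mul, norm_div]
      have h3 : 0 < (a / 2) ^ (m + 1) * (1 + ‖z‖) ^ (m + 1) := by positivity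
      calc ‖aeval z S‖ / ‖∏ j, (z + (t j : ℂ))‖
          ≤ (A * (1 + ‖z‖) ^ (m + 1)) / ((a / 2) ^ (m + 1) * (1 + ‖z‖) ^ (m + 1)) :=
            div_le_div₀ (by positivity) (hA z) h3 h1
        _ = A / (a / 2) ^ (m + 1) := mul_div_mul_right _ _ (by positivity)
    have h3 := (_root_.abs_le.1 ((Complex.abs_re_le_norm (f z)).trans h2)).1
    exact h3
  have hreal : ∀ s : ℝ, 0 ≤ s → (f s).re = 0 := by
    intro s _
    have : f s = -Complex.I * (((-1) ^ m * (S.eval s / ∏ j, (s + t j)) : ℝ) : ℂ) := by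
      simp only [hf, aeval_ofReal_eq]
      push_cast
      ring
    rw [this, Complex.re_mul_ofReal]
    simp
  have himag : ∀ y : ℝ, 0 ≤ y → (f (y * Complex.I)).re = y / ∏ j, (y ^ 2 + t j ^ 2) := by
    intro y hy
    have hB : 0 < ∏ j, (y ^ 2 + t j ^ 2) := Finset.prod_pos fun j _ => by
      have := ha0.trans_le (hta j); positivity
    set B := ∏ j, (y ^ 2 + t j ^ 2) with hBdef
    have h1 : (∏ j, ((y : ℂ) * Complex.I - t j)) * ∏ j, ((y : ℂ) * Complex.I + t j) =
        (((-1) ^ (m + 1) * B : ℝ) : ℂ) := by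
      rw [← Finset.prod_mul_distrib, hBdef]
      have h2 : ∀ j, ((y : ℂ) * Complex.I - t j) * ((y : ℂ) * Complex.I + t j) =
          (-1) * ((y ^ 2 + t j ^ 2 : ℝ) : ℂ) := by
        intro j; push_cast; linear_combination (y : ℂ) ^ 2 * Complex.I_sq
      rw [Finset.prod_congr rfl fun j _ => h2 j, Finset.prod_mul_distrib]
      simp
    have h3 := hFz (y * Complex.I)
    rw [aeval_sq_mul_I] at h3
    have hP := hprod _ (ofReal_mul_I_mem_closedQuadrant hy)
    have hm1 : (((-1) ^ (m + 1) * B : ℝ) : ℂ) ≠ 0 := by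
      rw [Complex.ofReal_ne_zero]
      exact mul_ne_zero (pow_ne_zero _ (by norm_num)) hB.ne'
    have h4 : aeval ((y : ℂ) * Complex.I) S / ∏ j, ((y : ℂ) * Complex.I + t j) =
        (((Q.eval (-y ^ 2) : ℝ) : ℂ) - y * Complex.I - w) / (((-1) ^ (m + 1) * B : ℝ) : ℂ) := by
      rw [div_eq_div_iff hP hm1, h3, ← h1]
      ring
    have h5 : (((Q.eval (-y ^ 2) : ℝ) : ℂ) - y * Complex.I - w).im = -y := by simp
    simp only [hf]
    rw [h4]
    have h6 : -Complex.I * (((-1) ^ m : ℝ) : ℂ) *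
        ((((Q.eval (-y ^ 2) : ℝ) : ℂ) - y * Complex.I - w) / (((-1) ^ (m + 1) * B : ℝ) : ℂ)) =
        Complex.I * (((Q.eval (-y ^ 2) : ℝ) : ℂ) - y * Complex.I - w) * ((1 / B : ℝ) : ℂ) := by
      have hB' : (B : ℂ) ≠ 0 := by exact_mod_cast hB.ne'
      have hmm : ((-1 : ℂ)) ^ m ≠ 0 := pow_ne_zero _ (by norm_num)
      push_cast
      rw [pow_succ]
      field_simp
      rw [pow_succ]
      ring
    rw [h6, Complex.re_mul_ofReal, Complex.I_mul_re, h5]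
    ring
  have hpos := re_pos_of_nonneg_on_boundary (f := f) (z₀ := Complex.I)
    (fun z hz => (hfd z (openQuadrant_subset hz)).differentiableWithinAt)
    (fun z hz => (hfd z hz).continuousAt.continuousWithinAt) hbound
    (fun s hs => (hreal s hs).ge)
    (fun y hy => by
      rw [himag y hy]
      exact div_nonneg hy (Finset.prod_nonneg fun j _ => by positivity))
    (by simp [closedQuadrant])
    (by
      have := himag 1 zero_le_one
      rw [Complex.ofReal_one, one_mul] at this
      rw [this]
      exact div_pos one_pos (Finset.prod_pos fun j _ => by positivity))
  intro hzw
  have h1 := hFz z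
  rw [hzw, sub_self, eq_comm, mul_eq_zero] at h1
  rcases h1 with h1 | h1
  · obtain ⟨j, -, hj⟩ := Finset.prod_eq_zero_iff.1 h1
    have := congrArg Complex.im hj
    simp at this
    exact absurd this hz.2.ne'
  · have := hpos z hz
    simp [hf, h1] at this

/-- In the quadrant, `Q(z²) - z` omits the interval `[-L, L]`. -/
lemma aeval_sub_ne (h : Equioscillates m a L Q x) (ha0 : 0 < a) (ha1 : a < 1) {w : ℝ}
    (hw : |w| ≤ L) {z : ℂ} (hz : z ∈ openQuadrant) : aeval (z ^ 2) Q - z ≠ w := by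
  intro hzw
  set g : ℂ → ℂ := fun z => aeval (z ^ 2) Q - z with hg
  have hgd : Differentiable ℂ g := by
    have := (Q.comp (X ^ 2)).differentiable_aeval (𝕜 := ℂ)
    simp only [aeval_comp_sq] at this
    exact this.sub differentiable_id
  have han : AnalyticOnNhd ℂ g openQuadrant := fun z _ => hgd.analyticAt z
  rcases han.is_constant_or_isOpen isPreconnected_openQuadrant with ⟨c, hc⟩ | hopen
  · have heq : EqOn g (fun _ => c) closedQuadrant :=
      EqOn.of_subset_closure (s := openQuadrant) (fun z hz => hc z hz)
        hgd.continuous.continuousOn continuousOn_const openQuadrant_subset closure_openQuadrant.ge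
    have hval : ∀ j ≤ m + 1, g (x j) = (((-1) ^ j * L : ℝ) : ℂ) := by
      intro j hj
      rw [← h.value j hj, hg]
      simp only
      rw [← Complex.ofReal_pow, aeval_ofReal_eq]
      push_cast; ring
    have hmem : ∀ j ≤ m + 1, ((x j : ℝ) : ℂ) ∈ closedQuadrant := fun j hj =>
      ofReal_mem_closedQuadrant (ha0.le.trans (h.node_mem hj).1)
    have h1 := (hval 0 (by omega)).symm.trans
      ((heq (hmem 0 (by omega))).trans ((heq (hmem 1 (by omega))).symm.trans (hval 1 (by omega))))
    have h2 := Complex.ofReal_injective h1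
    have := h.error_pos
    norm_num at h2
    linarith
  -- If `w` were a value, so would be `c w` for `c < 1` close to `1`, and `|c w| < L` is already
  -- excluded.
  · have ho := hopen openQuadrant subset_rfl isOpen_openQuadrant
    have hmem : (w : ℂ) ∈ g '' openQuadrant := ⟨z, hz, hzw⟩
    have hlim : Tendsto (fun c : ℝ => ((c * w : ℝ) : ℂ)) (𝓝[<] 1) (𝓝 (w : ℂ)) := by
      have : Tendsto (fun c : ℝ => ((c * w : ℝ) : ℂ)) (𝓝 1) (𝓝 ((1 * w : ℝ) : ℂ)) :=
        Continuous.tendsto (by fun_prop) 1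
      rw [one_mul] at this
      exact this.mono_left nhdsWithin_le_nhds
    obtain ⟨c, ⟨⟨z', hz', hz'c⟩, hc1⟩, hc0⟩ := ((hlim.eventually (ho.mem_nhds hmem)).and
      (self_mem_nhdsWithin (s := Iio (1 : ℝ)))).and
      (nhdsWithin_le_nhds (lt_mem_nhds (zero_lt_one' ℝ))) |>.exists
    refine h.aeval_sub_ne_of_abs_lt ha0 ha1 (w := c * w) ?_ hz' hz'c
    rw [abs_mul, abs_of_pos hc0]
    have hc1' : c < 1 := hc1
    nlinarith [h.error_pos, abs_nonneg w]

end Equioscillates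

/-- `φ` is a branch of `arccos ((Q(z²) - z) / L)` on the quadrant with values in the upper half
plane and bounded real part, normalized by `φ(a) = 0`. -/
structure IsArccosBranch (a L : ℝ) (Q : ℝ[X]) (φ : ℂ → ℂ) (B : ℝ) : Prop where
  continuousOn : ContinuousOn φ closedQuadrant
  differentiableOn : DifferentiableOn ℂ φ openQuadrant
  cos_eq : ∀ z ∈ closedQuadrant, aeval (z ^ 2) Q - z = L * Complex.cos (φ z)
  im_pos : ∀ z ∈ openQuadrant, 0 < (φ z).im
  abs_re_le : ∀ z ∈ openQuadrant, |(φ z).re| ≤ B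
  map_a : φ a = 0

lemma Equioscillates.exists_isArccosBranch {m : ℕ} {a L : ℝ} {Q : ℝ[X]} {x : ℕ → ℝ}
    (h : Equioscillates m a L Q x) (ha0 : 0 < a) (ha1 : a < 1) :
    ∃ (φ : ℂ → ℂ) (B : ℝ), IsArccosBranch a L Q φ B := by
  have hL : (L : ℂ) ≠ 0 := by exact_mod_cast h.error_pos.ne'
  set R : ℂ[X] := C (L : ℂ)⁻¹ * (Q.comp (X ^ 2) - X).map (algebraMap ℝ ℂ) with hR
  have hReval : ∀ z, R.eval z = (L : ℂ)⁻¹ * (aeval (z ^ 2) Q - z) := by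
    intro z
    rw [hR, eval_mul, eval_C, eval_map_algebraMap, map_sub, aeval_comp_sq, aeval_X]
  obtain ⟨φ, B, h1, h2, h3, h4, h5, h6⟩ := exists_arccos_branch (R := R) (a := a) (by
      intro z hz t ht heq
      rw [hReval, inv_mul_eq_iff_eq_mul₀ hL] at heq
      refine h.aeval_sub_ne ha0 ha1 (w := L * t) ?_ hz (by push_cast; exact heq)
      rw [abs_mul, abs_of_pos h.error_pos]
      exact mul_le_of_le_one_right h.error_pos.le (_root_.abs_le.2 ht)) ha0.le (by
      have h7 := h.value 0 (by omega)
      rw [h.node_zero, pow_zero, one_mul] at h7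
      rw [hReval, ← Complex.ofReal_pow, aeval_ofReal_eq, ← Complex.ofReal_sub, h7,
        inv_mul_cancel₀ hL])
  refine ⟨φ, B, h1, h2, fun z hz => ?_, h4, h5, h6⟩
  rw [h3 z hz, hReval, mul_inv_cancel_left₀ hL]

/-! ### The branch on the positive real axis -/

lemma cos_re_eq (w : ℂ) : (Complex.cos w).re = Real.cos w.re * Real.cosh w.im := by
  rw [Complex.cos_eq, ← Complex.ofReal_cos, ← Complex.ofReal_cosh, ← Complex.ofReal_sin,
    ← Complex.ofReal_sinh]
  simp only [Complex.sub_re, Complex.mul_re, Complex.mul_im, Complex.ofReal_re,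
    Complex.ofReal_im, Complex.I_re, Complex.I_im]
  ring

lemma cos_im_eq (w : ℂ) : (Complex.cos w).im = -(Real.sin w.re * Real.sinh w.im) := by
  rw [Complex.cos_eq, ← Complex.ofReal_cos, ← Complex.ofReal_cosh, ← Complex.ofReal_sin,
    ← Complex.ofReal_sinh]
  simp only [Complex.sub_im, Complex.mul_re, Complex.mul_im, Complex.ofReal_re,
    Complex.ofReal_im, Complex.I_re, Complex.I_im]
  ring

/-- A continuous angle that starts at `0` and keeps a positive sine can neither become negative nor
reach `π`. -/
lemma mem_Ioo_of_sin_pos {θ : ℝ → ℝ} {c d : ℝ} (hcd : c < d) (hθ : ContinuousOn θ (Icc c d))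
    (h0 : θ c = 0) (hsin : ∀ t ∈ Ioc c d, 0 < Real.sin (θ t)) : θ d ∈ Ioo 0 Real.pi := by
  constructor
  · by_contra hneg
    push Not at hneg
    have hlt : θ d < 0 := by
      refine lt_of_le_of_ne hneg fun h => ?_
      have := hsin d ⟨hcd, le_rfl⟩
      rw [h] at this
      simp at this
    obtain ⟨s, hs, hsμ⟩ := intermediate_value_Icc' hcd.le hθ
      -- The maximum keeps the level in `(-π, 0)`, where the sine is negative.
      (show max (θ d) (-(Real.pi / 2)) ∈ Icc (θ d) (θ c) from
        ⟨le_max_left _ _, by rw [h0]; exact max_le hlt.le (by linarith [Real.pi_pos])⟩)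
    have hμ : max (θ d) (-(Real.pi / 2)) < 0 := max_lt hlt (by linarith [Real.pi_pos])
    have hsc : c < s := lt_of_le_of_ne hs.1 fun h => by
      rw [← h, h0] at hsμ; linarith
    have h1 := hsin s ⟨hsc, hs.2⟩
    rw [hsμ] at h1
    have h2 := Real.sin_neg_of_neg_of_neg_pi_lt hμ
      (lt_of_lt_of_le (by linarith [Real.pi_pos]) (le_max_right _ _))
    linarith
  · by_contra hneg
    push Not at hneg
    obtain ⟨s, hs, hsμ⟩ := intermediate_value_Icc hcd.le hθ
      (show Real.pi ∈ Icc (θ c) (θ d) from ⟨by rw [h0]; exact Real.pi_pos.le, hneg⟩)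
    have hsc : c < s := lt_of_le_of_ne hs.1 fun h => by
      rw [← h, h0] at hsμ; linarith [Real.pi_pos]
    have h1 := hsin s ⟨hsc, hs.2⟩
    rw [hsμ] at h1
    simp at h1

lemma eq_of_sin_eq_zero {θ : ℝ → ℝ} {s : Set ℝ} (hs : s.OrdConnected) (hθ : ContinuousOn θ s)
    (hsin : ∀ t ∈ s, Real.sin (θ t) = 0) {t t' : ℝ} (ht : t ∈ s) (ht' : t' ∈ s) :
    θ t = θ t' := by
  refine hs.isPreconnected.constant_of_mapsTo (T := (AddSubgroup.zmultiples Real.pi : Set ℝ))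
    ⟨NormedSpace.discreteTopology_zmultiples _⟩ hθ (fun t ht => ?_) ht ht'
  obtain ⟨n, hn⟩ := Real.sin_eq_zero_iff.1 (hsin t ht)
  exact ⟨n, by simp [hn]⟩

namespace IsArccosBranch

variable {m : ℕ} {a L B : ℝ} {Q : ℝ[X]} {x : ℕ → ℝ} {φ : ℂ → ℂ}

lemma im_nonneg (b : IsArccosBranch a L Q φ B) {z : ℂ} (hz : z ∈ closedQuadrant) :
    0 ≤ (φ z).im := by
  have h1 : φ z ∈ closure (φ '' openQuadrant) := by
    have := b.continuousOn
    rw [← closure_openQuadrant] at this hz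
    exact this.image_closure (mem_image_of_mem φ hz)
  have h2 : closure (φ '' openQuadrant) ⊆ {w : ℂ | 0 ≤ w.im} :=
    closure_minimal (by rintro _ ⟨w, hw, rfl⟩; exact (b.im_pos w hw).le)
      (isClosed_le continuous_const Complex.continuous_im)
  exact h2 h1

lemma re_eq (b : IsArccosBranch a L Q φ B) {z : ℂ} (hz : z ∈ closedQuadrant) :
    (aeval (z ^ 2) Q - z).re = L * (Real.cos (φ z).re * Real.cosh (φ z).im) := by
  rw [b.cos_eq z hz, Complex.re_ofReal_mul, cos_re_eq]

lemma im_eq (b : IsArccosBranch a L Q φ B) {z : ℂ} (hz : z ∈ closedQuadrant) :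
    (aeval (z ^ 2) Q - z).im = -(L * (Real.sin (φ z).re * Real.sinh (φ z).im)) := by
  rw [b.cos_eq z hz, Complex.im_ofReal_mul, cos_im_eq]; ring

lemma real_re_eq (b : IsArccosBranch a L Q φ B) {t : ℝ} (ht : 0 ≤ t) :
    Q.eval (t ^ 2) - t = L * (Real.cos (φ t).re * Real.cosh (φ t).im) := by
  rw [← b.re_eq (ofReal_mem_closedQuadrant ht), ← Complex.ofReal_pow, aeval_ofReal_eq]
  simp

lemma real_im_eq (b : IsArccosBranch a L Q φ B) (hL : 0 < L) {t : ℝ} (ht : 0 ≤ t) :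
    Real.sin (φ t).re = 0 ∨ (φ t).im = 0 := by
  have h := b.im_eq (ofReal_mem_closedQuadrant ht)
  rw [← Complex.ofReal_pow, aeval_ofReal_eq] at h
  simpa [hL.ne'] using h

lemma imag_re_eq (b : IsArccosBranch a L Q φ B) {y : ℝ} (hy : 0 ≤ y) :
    Q.eval (-y ^ 2) =
      L * (Real.cos (φ (y * Complex.I)).re * Real.cosh (φ (y * Complex.I)).im) := by
  rw [← b.re_eq (ofReal_mul_I_mem_closedQuadrant hy), aeval_sq_mul_I]
  simp

/-- The functional equation of the curve: `Q(-y²)` is real, so only `-iy` contributes to the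
imaginary part. -/
lemma imag_im_eq (b : IsArccosBranch a L Q φ B) {y : ℝ} (hy : 0 ≤ y) :
    L * (Real.sin (φ (y * Complex.I)).re * Real.sinh (φ (y * Complex.I)).im) = y := by
  have h := b.im_eq (ofReal_mul_I_mem_closedQuadrant hy)
  rw [aeval_sq_mul_I] at h
  simp at h
  linarith

lemma continuousOn_real (b : IsArccosBranch a L Q φ B) :
    ContinuousOn (fun t : ℝ => φ t) (Ici 0) :=
  b.continuousOn.comp Complex.continuous_ofReal.continuousOn
    fun _ ht => ofReal_mem_closedQuadrant ht

lemma continuousOn_imag (b : IsArccosBranch a L Q φ B) :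
    ContinuousOn (fun y : ℝ => φ (y * Complex.I)) (Ici 0) :=
  b.continuousOn.comp (by fun_prop) fun _ ht => ofReal_mul_I_mem_closedQuadrant ht

lemma continuousOn_real_re (b : IsArccosBranch a L Q φ B) :
    ContinuousOn (fun t : ℝ => (φ t).re) (Ici 0) :=
  Complex.continuous_re.comp_continuousOn b.continuousOn_real

lemma sin_eq_zero_of_lt_abs (b : IsArccosBranch a L Q φ B) (hL : 0 < L) {t : ℝ} (ht : 0 ≤ t)
    (h : L < |Q.eval (t ^ 2) - t|) : Real.sin (φ t).re = 0 ∧ 0 < (φ t).im := by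
  have hv : (φ t).im ≠ 0 := by
    intro hv
    rw [b.real_re_eq ht, hv, Real.cosh_zero, mul_one, abs_mul, abs_of_pos hL] at h
    nlinarith [Real.abs_cos_le_one (φ t).re]
  exact ⟨(b.real_im_eq hL ht).resolve_right hv,
    lt_of_le_of_ne (b.im_nonneg (ofReal_mem_closedQuadrant ht)) hv.symm⟩

lemma im_eq_zero_of_abs_le (b : IsArccosBranch a L Q φ B) (hL : 0 < L) {t : ℝ} (ht : 0 ≤ t)
    (h : |Q.eval (t ^ 2) - t| ≤ L) : (φ t).im = 0 := by
  by_contra hv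
  have hsin := (b.real_im_eq hL ht).resolve_right hv
  have hcos : |Real.cos (φ t).re| = 1 := by
    rw [Real.abs_cos_eq_sqrt_one_sub_sin_sq, hsin]; simp
  rw [b.real_re_eq ht, abs_mul, abs_mul, hcos, abs_of_pos hL, one_mul,
    abs_of_pos (Real.cosh_pos _)] at h
  have := Real.one_lt_cosh.2 hv
  nlinarith

end IsArccosBranch

namespace Equioscillates

variable {m : ℕ} {a L : ℝ} {Q : ℝ[X]} {x : ℕ → ℝ}

lemma strictAntiOn_left (h : Equioscillates m a L Q x) :
    StrictAntiOn (fun t => Q.eval (t ^ 2) - t) (Icc 0 a) := by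
  refine strictAntiOn_of_deriv_neg (convex_Icc _ _) (by fun_prop) fun t ht => ?_
  rw [interior_Icc] at ht
  rw [(hasDerivAt_eval_sq_sub Q t).deriv]
  exact h.deriv_left t ht.1.le ht.2.le

lemma value_a (h : Equioscillates m a L Q x) : Q.eval (a ^ 2) - a = L := by
  have := h.value 0 (by omega)
  rwa [h.node_zero, pow_zero, one_mul] at this

lemma lt_value_left (h : Equioscillates m a L Q x) {t : ℝ} (h0 : 0 ≤ t) (hta : t < a) :
    L < Q.eval (t ^ 2) - t := by
  have := h.strictAntiOn_left ⟨h0, hta.le⟩ ⟨h0.trans hta.le, le_rfl⟩ hta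
  simp only [h.value_a] at this
  exact this

lemma lt_abs_value_right (h : Equioscillates m a L Q x) {t : ℝ} (ht : 1 < t) :
    L < |Q.eval (t ^ 2) - t| := by
  have hmono : StrictMonoOn (fun t => (-1) ^ (m + 1) * (Q.eval (t ^ 2) - t)) (Ici 1) := by
    refine strictMonoOn_of_deriv_pos (convex_Ici _) (by fun_prop) fun t ht => ?_
    rw [interior_Ici] at ht
    rw [((hasDerivAt_eval_sq_sub Q t).const_mul _).deriv]
    exact h.deriv_right t (le_of_lt ht)
  have h1 := hmono (mem_Ici.2 le_rfl) (mem_Ici.2 ht.le) ht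
  have h2 := h.value (m + 1) le_rfl
  rw [h.node_last] at h2
  simp only [h2] at h1
  rw [← mul_assoc, ← pow_add, ← two_mul, pow_mul] at h1
  norm_num at h1
  calc L < _ := h1
    _ ≤ |(-1) ^ (m + 1) * (Q.eval (t ^ 2) - t)| := le_abs_self _
    _ = _ := by rw [abs_mul, abs_pow]; simp

lemma strictAntiOn_between (h : Equioscillates m a L Q x) {j : ℕ} (hj : j ≤ m) :
    StrictAntiOn (fun t => (-1) ^ j * (Q.eval (t ^ 2) - t)) (Icc (x j) (x (j + 1))) := by
  refine strictAntiOn_of_deriv_neg (convex_Icc _ _) (by fun_prop) fun t ht => ?_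
  rw [interior_Icc] at ht
  rw [((hasDerivAt_eval_sq_sub Q t).const_mul _).deriv]
  have := h.deriv_sign j hj t ht
  rw [pow_succ] at this
  linarith

lemma neg_one_pow_mul_value (h : Equioscillates m a L Q x) {j : ℕ} (hj : j ≤ m + 1) :
    (-1) ^ j * (Q.eval (x j ^ 2) - x j) = L := by
  rw [h.value j hj, ← mul_assoc, ← pow_add, ← two_mul, pow_mul]; simp

lemma neg_one_pow_mul_value_succ (h : Equioscillates m a L Q x) {j : ℕ} (hj : j ≤ m) :
    (-1) ^ j * (Q.eval (x (j + 1) ^ 2) - x (j + 1)) = -L := by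
  rw [← h.neg_one_pow_mul_value (j := j + 1) (by omega), pow_succ]; ring

end Equioscillates

namespace IsArccosBranch

variable {m : ℕ} {a L B : ℝ} {Q : ℝ[X]} {x : ℕ → ℝ} {φ : ℂ → ℂ}

lemma re_eq_zero_left (b : IsArccosBranch a L Q φ B) (h : Equioscillates m a L Q x)
    {t : ℝ} (h0 : 0 ≤ t) (hta : t ≤ a) : (φ t).re = 0 := by
  have ha : (φ a).re = 0 := by rw [b.map_a]; simp
  rw [← ha]
  refine eq_of_sin_eq_zero (θ := fun t : ℝ => (φ t).re) (s := Icc 0 a) ordConnected_Icc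
    (b.continuousOn_real_re.mono fun t ht => ht.1) (fun s hs => ?_) ⟨h0, hta⟩
    ⟨h0.trans hta, le_rfl⟩
  rcases hs.2.eq_or_lt with rfl | hlt
  · rw [ha, Real.sin_zero]
  · exact (b.sin_eq_zero_of_lt_abs h.error_pos hs.1
      ((h.lt_value_left hs.1 hlt).trans_le (le_abs_self _))).1

/-- Sign of `sin u` between the nodes: the boundary is traversed with the upper half plane on the
left. -/
lemma sin_pos_between (b : IsArccosBranch a L Q φ B) (h : Equioscillates m a L Q x) (ha0 : 0 < a)
    {j : ℕ} (hj : j ≤ m) {t : ℝ} (ht : t ∈ Ioo (x j) (x (j + 1))) :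
    0 < (-1) ^ j * Real.sin (φ t).re := by
  have hL := h.error_pos
  have htI : t ∈ Icc a 1 :=
    ⟨(h.node_mem (by omega)).1.trans ht.1.le, ht.2.le.trans (h.node_mem (by omega)).2⟩
  have ht0 : 0 < t := ha0.trans_le htI.1
  have hne : Real.sin (φ t).re ≠ 0 := by
    intro hs
    have hv := b.im_eq_zero_of_abs_le hL ht0.le (h.abs_le t htI)
    have hr := b.real_re_eq ht0.le
    rw [hv, Real.cosh_zero, mul_one] at hr
    have hanti := h.strictAntiOn_between hj
    have hlt := h.node_lt j hj
    have h1 := hanti ⟨le_rfl, hlt.le⟩ ⟨ht.1.le, ht.2.le⟩ ht.1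
    have h2 := hanti ⟨ht.1.le, ht.2.le⟩ ⟨hlt.le, le_rfl⟩ ht.2
    simp only [h.neg_one_pow_mul_value (j := j) (by omega), h.neg_one_pow_mul_value_succ hj,
      hr] at h1 h2
    rcases neg_one_pow_eq_or ℝ j with h3 | h3 <;> rw [h3] at h1 h2 <;>
      rcases Real.sin_eq_zero_iff_cos_eq.1 hs with h4 | h4 <;> rw [h4] at h1 h2 <;> linarith
  set F : ℝ[X] := Q.comp (X ^ 2) - X with hF
  -- The vertical derivative of `Im F` at `t` is `F'(t)`, so `G > 0` just above the axis. There `Im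
  -- F = -L sin u sinh v` with `v > 0`, which determines the sign of `sin u` in the limit.
  set G : ℝ → ℝ := fun ε => (-1) ^ (j + 1) * (aeval ((t : ℂ) + ε * Complex.I) F).im with hG
  have hGd : HasDerivAt G ((-1) ^ (j + 1) * (2 * t * (derivative Q).eval (t ^ 2) - 1)) 0 := by
    have h1 : HasDerivAt (fun ε : ℝ => (t : ℂ) + ε * Complex.I) Complex.I 0 := by
      have := ((Complex.ofRealCLM.hasDerivAt (x := (0 : ℝ))).mul_const Complex.I).const_add (t : ℂ)
      simpa using this
    have h2 := HasDerivAt.comp (0 : ℝ) (F.hasDerivAt_aeval ((t : ℂ) + (0 : ℝ) * Complex.I)) h1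
    have h3 := (Complex.imCLM.hasFDerivAt.comp_hasDerivAt (0 : ℝ) h2).const_mul ((-1 : ℝ) ^ (j + 1))
    refine h3.congr_deriv ?_
    have h4 := F.hasDerivAt t
    simp only [hF, eval_sub, eval_comp, eval_pow, eval_X] at h4
    rw [Complex.ofReal_zero, zero_mul, add_zero, aeval_ofReal_eq, Complex.imCLM_apply,
      Complex.im_ofReal_mul, Complex.I_im, mul_one, hF, h4.unique (hasDerivAt_eval_sq_sub Q t)]
  have hG0 : G 0 = 0 := by
    simp only [hG, Complex.ofReal_zero, zero_mul, add_zero, aeval_ofReal_eq, Complex.ofReal_im,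
      mul_zero]
  have hslope := (hasDerivAt_iff_tendsto_slope.1 hGd).eventually
    (lt_mem_nhds (h.deriv_sign j hj t ht))
  have hev : ∀ᶠ ε : ℝ in 𝓝[>] 0, 0 ≤ (-1) ^ j * Real.sin (φ ((t : ℂ) + ε * Complex.I)).re := by
    filter_upwards [hslope.filter_mono (nhdsWithin_mono _ fun ε hε => ne_of_gt hε),
      self_mem_nhdsWithin] with ε h1 h2
    have hε : 0 < ε := h2
    have hmem : (t : ℂ) + ε * Complex.I ∈ openQuadrant := by
      simp [openQuadrant, ht0, hε]
    rw [slope_def_field, hG0, sub_zero, sub_zero] at h1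
    have h3 : 0 < G ε := by
      have := mul_pos h1 hε
      rwa [div_mul_cancel₀ _ hε.ne'] at this
    have h4 := b.im_eq (openQuadrant_subset hmem)
    have h5 : aeval ((t : ℂ) + ε * Complex.I) F =
        aeval (((t : ℂ) + ε * Complex.I) ^ 2) Q - ((t : ℂ) + ε * Complex.I) := by
      rw [hF, map_sub, aeval_comp_sq, aeval_X]
    simp only [hG] at h3
    rw [h5, h4, pow_succ] at h3
    have h6 := mul_pos hL (Real.sinh_pos_iff.2 (b.im_pos _ hmem))
    by_contra hneg
    push Not at hneg
    nlinarith
  have hlim : Tendsto (fun ε : ℝ => (-1) ^ j * Real.sin (φ ((t : ℂ) + ε * Complex.I)).re) (𝓝[>] 0)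
      (𝓝 ((-1) ^ j * Real.sin (φ t).re)) := by
    have h1 : ContinuousOn (fun ε : ℝ => φ ((t : ℂ) + ε * Complex.I)) (Ici 0) :=
      b.continuousOn.comp (by fun_prop) fun ε hε => by
        simpa [closedQuadrant, ht0.le] using hε
    have h2 : ContinuousOn
        (fun ε : ℝ => (-1) ^ j * Real.sin (φ ((t : ℂ) + ε * Complex.I)).re) (Ici 0) :=
      continuousOn_const.mul (Real.continuous_sin.comp_continuousOn
        (Complex.continuous_re.comp_continuousOn h1))
    have h3 := (h2 0 (mem_Ici.2 le_rfl)).tendsto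
    simp only [Complex.ofReal_zero, zero_mul, add_zero] at h3
    exact h3.mono_left (nhdsWithin_mono _ Ioi_subset_Ici_self)
  have hge := ge_of_tendsto hlim hev
  exact lt_of_le_of_ne hge (mul_ne_zero (pow_ne_zero _ (by norm_num)) hne).symm

/-- The angle `θ = u - jπ` stays in `[0, π]`, where the cosine is injective, and `L cos θ` is the
signed error, which falls from `L` to `-L`. So `θ` climbs from `0` to `π`. -/
lemma monotoneOn_between (b : IsArccosBranch a L Q φ B) (h : Equioscillates m a L Q x)
    (ha0 : 0 < a) {j : ℕ} (hj : j ≤ m) (hstart : (φ (x j)).re = j * Real.pi) :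
    MonotoneOn (fun t : ℝ => (φ t).re) (Icc (x j) (x (j + 1))) ∧
      (φ (x (j + 1))).re = (j + 1) * Real.pi := by
  have hL := h.error_pos
  have hlt := h.node_lt j hj
  have hpos : ∀ t ∈ Icc (x j) (x (j + 1)), 0 ≤ t := fun t ht =>
    ha0.le.trans ((h.node_mem (by omega)).1.trans ht.1)
  set θ : ℝ → ℝ := fun t => (φ t).re - j * Real.pi with hθ
  have hθc : ContinuousOn θ (Icc (x j) (x (j + 1))) :=
    (b.continuousOn_real_re.mono fun t ht => hpos t ht).sub continuousOn_const
  have hθ0 : θ (x j) = 0 := by simp [hθ, hstart]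
  have hsin : ∀ t, Real.sin (θ t) = (-1) ^ j * Real.sin (φ t).re := fun t =>
    Real.sin_sub_nat_mul_pi _ _
  have hcos : ∀ t ∈ Icc (x j) (x (j + 1)),
      L * Real.cos (θ t) = (-1) ^ j * (Q.eval (t ^ 2) - t) := by
    intro t ht
    have hv := b.im_eq_zero_of_abs_le hL (hpos t ht) (h.abs_le t
      ⟨(h.node_mem (by omega)).1.trans ht.1, ht.2.trans (h.node_mem (by omega)).2⟩)
    rw [b.real_re_eq (hpos t ht), hv, Real.cosh_zero, mul_one, hθ]
    simp only
    rw [Real.cos_sub_nat_mul_pi]; ring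
  have hIoo : ∀ t ∈ Ioo (x j) (x (j + 1)), θ t ∈ Icc 0 Real.pi := by
    intro t ht
    refine Ioo_subset_Icc_self (mem_Ioo_of_sin_pos ht.1
      (hθc.mono (Icc_subset_Icc_right ht.2.le)) hθ0 fun s hs => ?_)
    rw [hsin]
    exact b.sin_pos_between h ha0 hj ⟨hs.1, hs.2.trans_lt ht.2⟩
  have hIcc : ∀ t ∈ Icc (x j) (x (j + 1)), θ t ∈ Icc 0 Real.pi := by
    intro t ht
    have hcl : MapsTo θ (closure (Ioo (x j) (x (j + 1)))) (closure (Icc 0 Real.pi)) :=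
      MapsTo.closure_of_continuousOn hIoo (by rw [closure_Ioo hlt.ne]; exact hθc)
    rw [closure_Ioo hlt.ne, isClosed_Icc.closure_eq] at hcl
    exact hcl ht
  have hmono : MonotoneOn θ (Icc (x j) (x (j + 1))) := by
    intro s hs t ht hst
    by_contra hgt
    push Not at hgt
    have h1 := Real.strictAntiOn_cos (hIcc t ht) (hIcc s hs) hgt
    have h2 := (h.strictAntiOn_between hj).antitoneOn hs ht hst
    simp only [← hcos s hs, ← hcos t ht] at h2
    have := le_of_mul_le_mul_left h2 hL
    linarith
  refine ⟨fun s hs t ht hst => ?_, ?_⟩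
  · have := hmono hs ht hst
    simp only [hθ] at this
    simp only
    linarith
  · have hr : x (j + 1) ∈ Icc (x j) (x (j + 1)) := ⟨hlt.le, le_rfl⟩
    have h1 := hcos _ hr
    rw [h.neg_one_pow_mul_value_succ hj] at h1
    have h2 : Real.cos (θ (x (j + 1))) = Real.cos Real.pi := by
      rw [Real.cos_pi]
      have : L * (Real.cos (θ (x (j + 1))) + 1) = 0 := by linarith
      rcases mul_eq_zero.1 this with h3 | h3 <;> linarith
    have h3 := Real.injOn_cos (hIcc _ hr) ⟨Real.pi_pos.le, le_rfl⟩ h2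
    simp only [hθ] at h3
    linarith

lemma monotoneOn_nodes (b : IsArccosBranch a L Q φ B) (h : Equioscillates m a L Q x)
    (ha0 : 0 < a) {j : ℕ} (hj : j ≤ m + 1) :
    MonotoneOn (fun t : ℝ => (φ t).re) (Icc 0 (x j)) ∧ (φ (x j)).re = j * Real.pi := by
  induction j with
  | zero =>
    rw [h.node_zero]
    refine ⟨fun s hs t ht _ => ?_, by rw [b.map_a]; simp⟩
    simp only [b.re_eq_zero_left h hs.1 hs.2, b.re_eq_zero_left h ht.1 ht.2, le_refl]
  | succ j ih =>
    obtain ⟨h1, h2⟩ := ih (by omega)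
    obtain ⟨h3, h4⟩ := b.monotoneOn_between h ha0 (j := j) (by omega) h2
    have hle := (h.node_lt j (by omega)).le
    have h0 : 0 ≤ x j := ha0.le.trans (h.node_mem (by omega)).1
    refine ⟨?_, by push_cast; exact h4⟩
    rw [← Icc_union_Icc_eq_Icc h0 hle]
    exact h1.union_right h3 (isGreatest_Icc h0) (isLeast_Icc hle)

lemma re_one (b : IsArccosBranch a L Q φ B) (h : Equioscillates m a L Q x) (ha0 : 0 < a) :
    (φ (1 : ℝ)).re = (m + 1) * Real.pi := by
  have := (b.monotoneOn_nodes h ha0 le_rfl).2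
  rw [h.node_last] at this
  push_cast at this ⊢
  exact this

lemma re_eq_right (b : IsArccosBranch a L Q φ B) (h : Equioscillates m a L Q x) (ha0 : 0 < a)
    {t : ℝ} (ht : 1 ≤ t) : (φ t).re = (m + 1) * Real.pi := by
  have h1 := b.re_one h ha0
  rw [← h1]
  refine eq_of_sin_eq_zero (θ := fun t : ℝ => (φ t).re) (s := Ici 1) ordConnected_Ici
    (b.continuousOn_real_re.mono fun t ht => mem_Ici.2 (zero_le_one.trans (mem_Ici.1 ht)))
    (fun s hs => ?_) ht
    (mem_Ici.2 le_rfl)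
  rcases (mem_Ici.1 hs).eq_or_lt with rfl | hlt
  · rw [h1]
    have := Real.sin_nat_mul_pi (m + 1)
    push_cast at this
    exact this
  · exact (b.sin_eq_zero_of_lt_abs h.error_pos (zero_le_one.trans hs)
      (h.lt_abs_value_right hlt)).1

/-- The real part of `φ` increases along the positive real axis. -/
lemma monotoneOn_real (b : IsArccosBranch a L Q φ B) (h : Equioscillates m a L Q x) (ha0 : 0 < a) :
    MonotoneOn (fun t : ℝ => (φ t).re) (Ici 0) := by
  have h1 := (b.monotoneOn_nodes h ha0 le_rfl).1
  rw [h.node_last] at h1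
  have h2 : MonotoneOn (fun t : ℝ => (φ t).re) (Ici 1) := fun s hs t ht _ => by
    simp only [b.re_eq_right h ha0 hs, b.re_eq_right h ha0 ht, le_refl]
  rw [← Icc_union_Ici_eq_Ici (zero_le_one' ℝ)]
  exact h1.union_right h2 (isGreatest_Icc zero_le_one) isLeast_Ici

end IsArccosBranch

/-! ### The branch on the positive imaginary axis -/

namespace Equioscillates

variable {m : ℕ} {a L : ℝ} {Q : ℝ[X]} {x : ℕ → ℝ}

lemma eval_zero_pos (h : Equioscillates m a L Q x) (ha0 : 0 < a) : L < Q.eval 0 := by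
  simpa using h.lt_value_left le_rfl ha0

lemma strictAntiOn_imag (h : Equioscillates m a L Q x) :
    StrictAntiOn (fun y => Q.eval (-y ^ 2)) (Ici 0) := by
  have hmono : StrictMonoOn (fun t => Q.eval t) (Iic 0) := by
    refine strictMonoOn_of_deriv_pos (convex_Iic _) (by fun_prop) fun t ht => ?_
    rw [interior_Iic] at ht
    rw [Polynomial.deriv]
    exact h.derivative_pos t (le_of_lt ht)
  intro s hs t ht hst
  refine hmono (mem_Iic.2 (by nlinarith [sq_nonneg t])) (mem_Iic.2 (by nlinarith [sq_nonneg s])) ?_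
  have : s ^ 2 < t ^ 2 := pow_lt_pow_left₀ hst hs (by norm_num)
  linarith

lemma concaveOn_imag (h : Equioscillates m a L Q x) :
    ConcaveOn ℝ (Ici 0) (fun y => Q.eval (-y ^ 2)) := by
  have hanti : AntitoneOn (fun t => (derivative Q).eval t) (Iic 0) := by
    refine antitoneOn_of_deriv_nonpos (convex_Iic _) (by fun_prop)
      (derivative Q).differentiable.differentiableOn fun t ht => ?_
    rw [interior_Iic] at ht
    rw [Polynomial.deriv]
    exact h.derivative_derivative_nonpos t (le_of_lt ht)
  have hd : ∀ y, HasDerivAt (fun y => Q.eval (-y ^ 2)) (-2 * y * (derivative Q).eval (-y ^ 2)) y := by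
    intro y
    have := (Q.hasDerivAt (-y ^ 2)).comp y (hasDerivAt_pow 2 y).neg
    refine this.congr_deriv ?_
    push_cast; ring
  refine AntitoneOn.concaveOn_of_deriv (convex_Ici _)
    (fun y _ => (hd y).continuousAt.continuousWithinAt)
    (fun y _ => (hd y).differentiableAt.differentiableWithinAt) ?_
  rw [interior_Ici]
  intro s hs t ht hst
  rw [(hd s).deriv, (hd t).deriv]
  have hs0 : 0 < s := hs
  have h1 : (derivative Q).eval (-s ^ 2) ≤ (derivative Q).eval (-t ^ 2) :=
    hanti (mem_Iic.2 (by nlinarith [sq_nonneg t])) (mem_Iic.2 (by nlinarith [sq_nonneg s]))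
      (by nlinarith)
  have h2 := h.derivative_pos (-s ^ 2) (by nlinarith)
  nlinarith [mul_le_mul hst h1 h2.le (hs0.le.trans hst)]

/-- A concave function with a positive value at `0` has a strictly decreasing quotient by `y`. -/
lemma imag_mul_lt (h : Equioscillates m a L Q x) (ha0 : 0 < a) {y₁ y₂ : ℝ} (h1 : 0 < y₁)
    (h12 : y₁ < y₂) : y₁ * Q.eval (-y₂ ^ 2) < y₂ * Q.eval (-y₁ ^ 2) := by
  have hy2 : 0 < y₂ := h1.trans h12
  have hc := h.concaveOn_imag.2 (mem_Ici.2 le_rfl) (mem_Ici.2 hy2.le)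
    (show (0 : ℝ) ≤ 1 - y₁ / y₂ from sub_nonneg.2 ((div_le_one hy2).2 h12.le))
    (show (0 : ℝ) ≤ y₁ / y₂ by positivity) (by ring)
  simp only [smul_eq_mul, mul_zero, zero_add, div_mul_cancel₀ _ hy2.ne'] at hc
  have h0 : 0 < Q.eval (-0 ^ 2) := by
    have := h.eval_zero_pos ha0
    simpa using h.error_pos.trans this
  have h3 : y₂ * ((1 - y₁ / y₂) * Q.eval (-0 ^ 2) + y₁ / y₂ * Q.eval (-y₂ ^ 2)) =
      (y₂ - y₁) * Q.eval (-0 ^ 2) + y₁ * Q.eval (-y₂ ^ 2) := by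
    field_simp
  have h4 := mul_le_mul_of_nonneg_left hc hy2.le
  rw [h3] at h4
  nlinarith [mul_pos (sub_pos.2 h12) h0]

end Equioscillates

namespace IsArccosBranch

variable {m : ℕ} {a L B : ℝ} {Q : ℝ[X]} {x : ℕ → ℝ} {φ : ℂ → ℂ}

lemma map_zero_re (b : IsArccosBranch a L Q φ B) (h : Equioscillates m a L Q x) (ha0 : 0 < a) :
    (φ 0).re = 0 := by
  have := b.re_eq_zero_left h le_rfl ha0.le
  simpa using this

lemma map_zero_im_pos (b : IsArccosBranch a L Q φ B) (h : Equioscillates m a L Q x)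
    (ha0 : 0 < a) : 0 < (φ 0).im := by
  have := (b.sin_eq_zero_of_lt_abs h.error_pos le_rfl
      ((h.lt_value_left le_rfl ha0).trans_le (le_abs_self _))).2
  simpa using this

lemma imag_im_pos (b : IsArccosBranch a L Q φ B) (hL : 0 < L) {y : ℝ} (hy : 0 < y) :
    0 < (φ (y * Complex.I)).im ∧ 0 < Real.sin (φ (y * Complex.I)).re := by
  have h1 := b.imag_im_eq hy.le
  have h2 := b.im_nonneg (ofReal_mul_I_mem_closedQuadrant hy.le)
  have h3 : 0 < (φ (y * Complex.I)).im := by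
    refine lt_of_le_of_ne h2 fun h0 => ?_
    rw [← h0] at h1
    simp at h1
    exact hy.ne h1
  refine ⟨h3, ?_⟩
  have h4 := mul_pos hL (Real.sinh_pos_iff.2 h3)
  by_contra hneg
  push Not at hneg
  nlinarith

lemma imag_re_mem (b : IsArccosBranch a L Q φ B) (h : Equioscillates m a L Q x) (ha0 : 0 < a)
    {y : ℝ} (hy : 0 < y) : (φ (y * Complex.I)).re ∈ Ioo 0 Real.pi := by
  refine mem_Ioo_of_sin_pos (θ := fun y : ℝ => (φ (y * Complex.I)).re) hy
    (Complex.continuous_re.comp_continuousOn (b.continuousOn_imag.mono fun t ht => ht.1)) ?_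
    fun t ht => (b.imag_im_pos h.error_pos ht.1).2
  simpa using b.map_zero_re h ha0

/-- The real part of `φ` increases along the positive imaginary axis. -/
lemma imag_re_lt (b : IsArccosBranch a L Q φ B) (h : Equioscillates m a L Q x) (ha0 : 0 < a)
    {y₁ y₂ : ℝ} (hy1 : 0 < y₁) (h12 : y₁ < y₂) :
    (φ (y₁ * Complex.I)).re < (φ (y₂ * Complex.I)).re := by
  have hL := h.error_pos
  have hy2 : 0 < y₂ := hy1.trans h12
  have hu1 := b.imag_re_mem h ha0 hy1
  have hu2 := b.imag_re_mem h ha0 hy2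
  have hv1 := (b.imag_im_pos hL hy1).1
  have hv2 := (b.imag_im_pos hL hy2).1
  have hs1 := (b.imag_im_pos hL hy1).2
  have hs2 := (b.imag_im_pos hL hy2).2
  have hp1 := b.imag_re_eq hy1.le
  have hp2 := b.imag_re_eq hy2.le
  have hq1 := b.imag_im_eq hy1.le
  have hq2 := b.imag_im_eq hy2.le
  have hp := h.strictAntiOn_imag (mem_Ici.2 hy1.le) (mem_Ici.2 hy2.le) h12
  have hpy := h.imag_mul_lt ha0 hy1 h12
  simp only at hp
  rw [hp1, hp2] at hp hpy
  set u₁ := (φ (y₁ * Complex.I)).re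
  set u₂ := (φ (y₂ * Complex.I)).re
  set v₁ := (φ (y₁ * Complex.I)).im
  set v₂ := (φ (y₂ * Complex.I)).im
  by_contra hle
  push Not at hle
  have hcos : Real.cos u₁ ≤ Real.cos u₂ :=
    Real.strictAntiOn_cos.antitoneOn ⟨hu2.1.le, hu2.2.le⟩ ⟨hu1.1.le, hu1.2.le⟩ hle
  have hC1 := Real.cosh_pos v₁
  have hC2 := Real.cosh_pos v₂
  have hS1 := Real.sinh_pos_iff.2 hv1
  have hS2 := Real.sinh_pos_iff.2 hv2
  have hp' : Real.cos u₂ * Real.cosh v₂ < Real.cos u₁ * Real.cosh v₁ := lt_of_mul_lt_mul_left hp hL.le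
  have hsq1 := Real.sin_sq_add_cos_sq u₁
  have hsq2 := Real.sin_sq_add_cos_sq u₂
  -- Assuming `u₂ ≤ u₁`. If `cos u₂ ≥ 0`, the decrease of `p = L cos u cosh v` forces `v₂ < v₁`, and
  -- then `y = L sin u sinh v` would decrease. If `cos u₂ < 0`, it forces `v₁ < v₂`, and the
  -- comparison of hyperbolic tangents contradicts the decrease of `p / y`.
  rcases le_or_gt 0 (Real.cos u₂) with hc2 | hc2
  · have hc1 : 0 < Real.cos u₁ := by
      by_contra hneg
      push Not at hneg
      linarith [mul_nonneg hc2 hC2.le, mul_nonpos_of_nonpos_of_nonneg hneg hC1.le]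
    have hcosh : Real.cosh v₂ < Real.cosh v₁ := by
      by_contra hneg
      push Not at hneg
      linarith [mul_le_mul hcos hneg hC1.le hc2]
    have hv : v₂ < v₁ := by
      have := Real.cosh_lt_cosh.1 hcosh
      rwa [abs_of_pos hv1, abs_of_pos hv2] at this
    have hsinh : Real.sinh v₂ < Real.sinh v₁ := Real.sinh_lt_sinh.2 hv
    have hsin : Real.sin u₂ ≤ Real.sin u₁ := by
      have : Real.sin u₂ ^ 2 ≤ Real.sin u₁ ^ 2 := by
        linarith [pow_le_pow_left₀ hc1.le hcos 2]
      exact (sq_le_sq₀ hs2.le hs1.le).1 this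
    have h1 : Real.sin u₂ * Real.sinh v₂ < Real.sin u₁ * Real.sinh v₁ :=
      mul_lt_mul_of_le_of_lt_of_pos_of_nonneg hsin hsinh hs2 hS1.le
    linarith [mul_lt_mul_of_pos_left h1 hL]
  · have hsin : Real.sin u₁ ≤ Real.sin u₂ := by
      have : Real.sin u₁ ^ 2 ≤ Real.sin u₂ ^ 2 := by
        have := pow_le_pow_left₀ (neg_nonneg.2 hc2.le) (neg_le_neg hcos) 2
        rw [neg_sq, neg_sq] at this
        linarith
      exact (sq_le_sq₀ hs1.le hs2.le).1 this
    have hcosh : Real.cosh v₁ < Real.cosh v₂ := by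
      by_contra hneg
      push Not at hneg
      linarith [mul_le_mul (neg_le_neg hcos) hneg hC2.le (by linarith)]
    have hv : v₁ < v₂ := by
      have := Real.cosh_lt_cosh.1 hcosh
      rwa [abs_of_pos hv1, abs_of_pos hv2] at this
    have h1 : 0 < Real.sinh (v₂ - v₁) := Real.sinh_pos_iff.2 (by linarith)
    rw [Real.sinh_sub] at h1
    rw [← hq1, ← hq2] at hpy
    have h2 : L * L * ((-Real.cos u₁) * Real.sin u₂ * (Real.sinh v₂ * Real.cosh v₁)) <
        L * L * ((-Real.cos u₂) * Real.sin u₁ * (Real.cosh v₂ * Real.sinh v₁)) := by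
      linarith [hpy]
    have h3 := lt_of_mul_lt_mul_left h2 (mul_pos hL hL).le
    have h4 : (-Real.cos u₂) * Real.sin u₁ ≤ (-Real.cos u₁) * Real.sin u₂ :=
      mul_le_mul (neg_le_neg hcos) hsin hs1.le (by linarith)
    have h5 : (-Real.cos u₂) * Real.sin u₁ * (Real.cosh v₂ * Real.sinh v₁) ≤
        (-Real.cos u₁) * Real.sin u₂ * (Real.sinh v₂ * Real.cosh v₁) :=
      mul_le_mul h4 (by linarith) (mul_pos hC2 hS1).le
        ((mul_pos (neg_pos.2 hc2) hs1).le.trans h4)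
    linarith

/-! ### Monotonicity along rays and injectivity -/

/-- The image of the open quadrant lies in the half-strip. -/
lemma mapsTo_halfStrip (b : IsArccosBranch a L Q φ B) (h : Equioscillates m a L Q x)
    (ha0 : 0 < a) : MapsTo φ openQuadrant (halfStrip ((m + 1) * Real.pi)) := by
  have hW : Real.pi ≤ (m + 1) * Real.pi := by
    nlinarith [Real.pi_pos, (Nat.cast_nonneg m : (0 : ℝ) ≤ m)]
  have hmono := b.monotoneOn_real h ha0
  have h0 : (φ ((0 : ℝ) : ℂ)).re = 0 := b.re_eq_zero_left h le_rfl ha0.le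
  have hnonneg : ∀ t : ℝ, 0 ≤ t → 0 ≤ (φ t).re := fun t ht => by
    have := hmono (mem_Ici.2 le_rfl) ht ht
    simp only [h0] at this
    exact this
  have hle : ∀ t : ℝ, 0 ≤ t → (φ t).re ≤ (m + 1) * Real.pi := fun t ht => by
    rcases le_or_gt t 1 with h1 | h1
    · have := hmono ht (mem_Ici.2 zero_le_one) h1
      simp only [b.re_one h ha0] at this
      exact this
    · exact (b.re_eq_right h ha0 h1.le).le
  have himag : ∀ y : ℝ, 0 ≤ y → 0 ≤ (φ (y * Complex.I)).re ∧
      (φ (y * Complex.I)).re ≤ (m + 1) * Real.pi := by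
    intro y hy
    rcases hy.eq_or_lt with rfl | hy
    · have : (φ (((0 : ℝ) : ℂ) * Complex.I)).re = 0 := by simpa using b.map_zero_re h ha0
      rw [this]
      exact ⟨le_rfl, Real.pi_pos.le.trans hW⟩
    · have := b.imag_re_mem h ha0 hy
      exact ⟨this.1.le, this.2.le.trans hW⟩
  have hone := b.re_one h ha0
  have hpos := re_pos_of_nonneg_on_boundary b.differentiableOn b.continuousOn
    (fun z hz => (abs_le.1 (b.abs_re_le z hz)).1) hnonneg (fun y hy => (himag y hy).1)
    (ofReal_mem_closedQuadrant zero_le_one) (by rw [hone]; exact Real.pi_pos.trans_le hW)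
  have hlt := re_pos_of_nonneg_on_boundary (f := fun z => (((m + 1) * Real.pi : ℝ) : ℂ) - φ z)
    (C := B - (m + 1) * Real.pi)
    ((differentiableOn_const _).sub b.differentiableOn) (continuousOn_const.sub b.continuousOn)
    (fun z hz => by
      rw [Complex.sub_re, Complex.ofReal_re]
      linarith [(abs_le.1 (b.abs_re_le z hz)).2])
    (fun t ht => by
      rw [Complex.sub_re, Complex.ofReal_re]
      linarith [hle t ht])
    (fun t ht => by
      rw [Complex.sub_re, Complex.ofReal_re]
      linarith [(himag t ht).2])
    (ofReal_mem_closedQuadrant le_rfl)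
    (by
      rw [Complex.sub_re, Complex.ofReal_re, h0]
      linarith [Real.pi_pos])
  intro z hz
  have := hlt z hz
  rw [Complex.sub_re, Complex.ofReal_re] at this
  exact ⟨hpos z hz, by linarith, b.im_pos z hz⟩

/-- The real part of `φ` increases along rays. -/
lemma re_lt_re_mul (b : IsArccosBranch a L Q φ B) (h : Equioscillates m a L Q x) (ha0 : 0 < a)
    {c : ℝ} (hc : 1 < c) {z : ℂ} (hz : z ∈ openQuadrant) : (φ z).re < (φ (c * z)).re := by
  have hc0 : 0 < c := one_pos.trans hc
  have hmul : ∀ z ∈ openQuadrant, (c : ℂ) * z ∈ openQuadrant := fun z hz => by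
    simpa [openQuadrant, hc0] using hz
  have hmul' : ∀ z ∈ closedQuadrant, (c : ℂ) * z ∈ closedQuadrant := fun z hz => by
    simpa [closedQuadrant, hc0] using hz
  -- Monotonicity of `u` on the two half-axes is the boundary hypothesis; strictness comes from the
  -- point `i`.
  have key := re_pos_of_nonneg_on_boundary (f := fun z => φ (c * z) - φ z) (C := B + B)
    ((b.differentiableOn.comp ((differentiableOn_const _).mul differentiableOn_id) hmul).sub
      b.differentiableOn)
    ((b.continuousOn.comp (continuousOn_const.mul continuousOn_id) hmul').sub b.continuousOn)
    (fun z hz => by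
      rw [Complex.sub_re]
      linarith [(abs_le.1 (b.abs_re_le z hz)).2, (abs_le.1 (b.abs_re_le _ (hmul z hz))).1])
    (fun t ht => by
      rw [Complex.sub_re, ← Complex.ofReal_mul]
      have := b.monotoneOn_real h ha0 (mem_Ici.2 ht) (mem_Ici.2 (mul_nonneg hc0.le ht))
        (le_mul_of_one_le_left ht hc.le)
      simp only at this
      linarith)
    (fun y hy => by
      rw [Complex.sub_re, ← mul_assoc, ← Complex.ofReal_mul]
      rcases hy.eq_or_lt with rfl | hy
      · simp
      · have := b.imag_re_lt h ha0 hy (lt_mul_of_one_lt_left hy hc)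
        linarith)
    (ofReal_mul_I_mem_closedQuadrant zero_le_one) (by
      rw [Complex.sub_re, ← mul_assoc, ← Complex.ofReal_mul]
      have := b.imag_re_lt h ha0 one_pos (lt_mul_of_one_lt_left one_pos hc)
      linarith) z hz
  rw [Complex.sub_re] at key
  linarith

end IsArccosBranch

lemma exp_mem_openQuadrant {w : ℂ} (h0 : 0 < w.im) (h1 : w.im < Real.pi / 2) :
    Complex.exp w ∈ openQuadrant := by
  refine ⟨?_, ?_⟩
  · rw [Complex.exp_re]
    exact mul_pos (Real.exp_pos _) (Real.cos_pos_of_mem_Ioo ⟨by linarith, h1⟩)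
  · rw [Complex.exp_im]
    exact mul_pos (Real.exp_pos _) (Real.sin_pos_of_pos_of_lt_pi h0 (by linarith))

namespace IsArccosBranch

variable {m : ℕ} {a L B : ℝ} {Q : ℝ[X]} {x : ℕ → ℝ} {φ : ℂ → ℂ}

lemma hasDerivAt_ray (b : IsArccosBranch a L Q φ B) {z : ℂ} {c : ℝ}
    (hz : (c : ℂ) * z ∈ openQuadrant) :
    HasDerivAt (fun c : ℝ => (φ (c * z)).re) (z * deriv φ (c * z)).re c := by
  have h1 : HasDerivAt φ (deriv φ (c * z)) (c * z) :=
    (b.differentiableOn.differentiableAt (isOpen_openQuadrant.mem_nhds hz)).hasDerivAt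
  have h2 : HasDerivAt (fun c : ℝ => (c : ℂ) * z) z c := by
    simpa using (Complex.ofRealCLM.hasDerivAt (x := c)).mul_const z
  have h3 := Complex.reCLM.hasFDerivAt.comp_hasDerivAt c (HasDerivAt.comp c h1 h2)
  refine h3.congr_deriv ?_
  rw [Complex.reCLM_apply, mul_comm]

/-- This is the derivative of `Re φ(cz)` at `c = 1`, hence nonnegative. A zero would, by the maximum
principle for `exp(-z φ')`, make it vanish identically, and `Re φ` would be constant along rays. -/
lemma re_mul_deriv_pos (b : IsArccosBranch a L Q φ B) (h : Equioscillates m a L Q x)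
    (ha0 : 0 < a) {z : ℂ} (hz : z ∈ openQuadrant) : 0 < (z * deriv φ z).re := by
  have hnonneg : ∀ z ∈ openQuadrant, 0 ≤ (z * deriv φ z).re := by
    intro z hz
    have hd := b.hasDerivAt_ray (z := z) (c := 1) (by simpa using hz)
    rw [Complex.ofReal_one, one_mul] at hd
    have hlim := (hasDerivAt_iff_tendsto_slope.1 hd).mono_left
      (nhdsWithin_mono (1 : ℝ) fun c (hc : c ∈ Ioi 1) => ne_of_gt hc)
    refine ge_of_tendsto hlim ?_
    filter_upwards [self_mem_nhdsWithin] with c hc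
    rw [slope_def_field, Complex.ofReal_one, one_mul]
    have h1 := b.re_lt_re_mul h ha0 hc hz
    have h2 : (1 : ℝ) < c := hc
    exact div_nonneg (by linarith) (by linarith)
  by_contra hneg
  push Not at hneg
  set g : ℂ → ℂ := fun w => Complex.exp (-(w * deriv φ w)) with hg
  have hnorm : ∀ w, ‖g w‖ = Real.exp (-(w * deriv φ w).re) := fun w => by
    rw [hg, Complex.norm_exp, Complex.neg_re]
  have hgd : DifferentiableOn ℂ g openQuadrant :=
    (differentiableOn_id.mul (b.differentiableOn.deriv isOpen_openQuadrant)).neg.cexp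
  have hz1 : 1 ≤ ‖g z‖ := by
    rw [hnorm]; exact Real.one_le_exp (by linarith)
  have hle : ∀ w ∈ openQuadrant, ‖g w‖ ≤ 1 := fun w hw => by
    rw [hnorm]; exact Real.exp_le_one_iff.2 (by linarith [hnonneg w hw])
  have heq := Complex.eqOn_of_isPreconnected_of_isMaxOn_norm isPreconnected_openQuadrant
    isOpen_openQuadrant hgd hz (fun w hw => (hle w hw).trans hz1)
  have hzero : ∀ w ∈ openQuadrant, (w * deriv φ w).re = 0 := by
    intro w hw
    have h1 : ‖g w‖ = ‖g z‖ := by rw [heq hw]; rfl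
    rw [hnorm] at h1
    have h2 : (w * deriv φ w).re ≤ 0 := by
      have := Real.one_le_exp_iff.1 (hz1.trans h1.ge)
      linarith
    exact le_antisymm h2 (hnonneg w hw)
  have hray : ∀ c : ℝ, c ∈ Icc (1 : ℝ) 2 → (c : ℂ) * z ∈ openQuadrant := fun c hc => by
    have : 0 < c := one_pos.trans_le hc.1
    simpa [openQuadrant, this] using hz
  have hder : ∀ c ∈ Icc (1 : ℝ) 2, HasDerivAt (fun c : ℝ => (φ (c * z)).re) 0 c := by
    intro c hc
    have h1 := b.hasDerivAt_ray (hray c hc)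
    have h2 := hzero _ (hray c hc)
    rw [mul_assoc, Complex.re_ofReal_mul] at h2
    rcases mul_eq_zero.1 h2 with h3 | h3
    · linarith [hc.1]
    · rwa [h3] at h1
  have hconst := constant_of_has_deriv_right_zero
    (f := fun c : ℝ => (φ (c * z)).re) (a := 1) (b := 2)
    (fun c hc => (hder c hc).continuousAt.continuousWithinAt)
    (fun c hc => (hder c ⟨hc.1, hc.2.le⟩).hasDerivWithinAt) 2 ⟨by norm_num, le_rfl⟩
  have hlt := b.re_lt_re_mul h ha0 (c := 2) (by norm_num) hz
  simp only [Complex.ofReal_one, one_mul] at hconst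
  rw [hconst] at hlt
  exact lt_irrefl _ hlt

/-- `φ` is injective on the quadrant, and an interior value is not taken on the boundary away from
the origin. -/
lemma eq_of_map_eq (b : IsArccosBranch a L Q φ B) (h : Equioscillates m a L Q x) (ha0 : 0 < a)
    {z₁ z₂ : ℂ} (h1 : z₁ ∈ openQuadrant) (h2 : z₂ ∈ closedQuadrant) (h20 : z₂ ≠ 0)
    (heq : φ z₁ = φ z₂) : z₁ = z₂ := by
  have h10 : z₁ ≠ 0 := fun h0 => by rw [h0] at h1; exact lt_irrefl _ h1.1
  set w₁ := Complex.log z₁ with hw1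
  set w₂ := Complex.log z₂ with hw2
  have he1 : Complex.exp w₁ = z₁ := Complex.exp_log h10
  have he2 : Complex.exp w₂ = z₂ := Complex.exp_log h20
  have hi1 : 0 < w₁.im ∧ w₁.im < Real.pi / 2 := by
    rw [hw1, Complex.log_im]
    refine ⟨lt_of_le_of_ne (Complex.arg_nonneg_iff.2 h1.2.le) fun h0 => ?_,
      lt_of_le_of_ne (Complex.arg_le_pi_div_two_iff.2 (Or.inl h1.1.le)) fun h0 => ?_⟩
    · exact h1.2.ne' (Complex.arg_eq_zero_iff.1 h0.symm).2
    · exact h1.1.ne' (Complex.arg_eq_pi_div_two_iff.1 h0).1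
  have hi2 : 0 ≤ w₂.im ∧ w₂.im ≤ Real.pi / 2 := by
    rw [hw2, Complex.log_im]
    exact ⟨Complex.arg_nonneg_iff.2 h2.2, Complex.arg_le_pi_div_two_iff.2 (Or.inl h2.1)⟩
  set δ := w₂ - w₁ with hδ
  by_contra hne
  have hδ0 : δ ≠ 0 := fun h0 => hne (by
    rw [← he1, ← he2, sub_eq_zero.1 h0])
  set p : ℝ → ℂ := fun t => w₁ + t * δ with hp
  have hpin : ∀ t : ℝ, 0 ≤ t → t < 1 → Complex.exp (p t) ∈ openQuadrant := by
    intro t ht0 ht1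
    have him : (p t).im = (1 - t) * w₁.im + t * w₂.im := by
      simp only [hp, hδ, Complex.add_im, Complex.im_ofReal_mul, Complex.sub_im]; ring
    refine exp_mem_openQuadrant ?_ ?_ <;> rw [him]
    · nlinarith [mul_pos (sub_pos.2 ht1) hi1.1, mul_nonneg ht0 hi2.1]
    · nlinarith [mul_pos (sub_pos.2 ht1) (sub_pos.2 hi1.2),
        mul_nonneg ht0 (sub_nonneg.2 hi2.2)]
  have hp0 : Complex.exp (p 0) = z₁ := by simp [hp, he1]
  have hp1 : Complex.exp (p 1) = z₂ := by simp [hp, hδ, he2]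
  -- In logarithmic coordinates the quadrant is the convex strip `0 < Im < π/2`. Along the segment
  -- from `w₁` to `w₂` the derivative of `N` is `|δ|² Re(z φ'(z)) > 0`. Only the open segment
  -- matters, so `z₂` may lie on the boundary.
  set N : ℝ → ℝ := fun t => ((starRingEnd ℂ) δ * φ (Complex.exp (p t))).re with hN
  have hNc : ContinuousOn N (Icc 0 1) := by
    refine Complex.continuous_re.comp_continuousOn (continuousOn_const.mul
      (b.continuousOn.comp (by fun_prop) fun t ht => ?_))
    rcases ht.2.eq_or_lt with rfl | hlt
    · rw [hp1]; exact h2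
    · exact openQuadrant_subset (hpin t ht.1 hlt)
  have hNd : ∀ t ∈ Ioo (0 : ℝ) 1, 0 < deriv N t := by
    intro t ht
    have hmem := hpin t ht.1.le ht.2
    have d1 : HasDerivAt φ (deriv φ (Complex.exp (p t))) (Complex.exp (p t)) :=
      (b.differentiableOn.differentiableAt (isOpen_openQuadrant.mem_nhds hmem)).hasDerivAt
    have d2 : HasDerivAt p δ t := by
      exact (((Complex.ofRealCLM.hasDerivAt (x := t)).mul_const δ).const_add w₁).congr_deriv
        (by simp)
    have d3 := (HasDerivAt.comp t d1 d2.cexp).const_mul ((starRingEnd ℂ) δ)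
    have d4 := Complex.reCLM.hasFDerivAt.comp_hasDerivAt t d3
    have d5 : HasDerivAt N _ t := d4
    rw [d5.deriv]
    have : (starRingEnd ℂ) δ * (deriv φ (Complex.exp (p t)) * (Complex.exp (p t) * δ)) =
        ((Complex.normSq δ : ℝ) : ℂ) * (Complex.exp (p t) * deriv φ (Complex.exp (p t))) := by
      rw [Complex.normSq_eq_conj_mul_self]; ring
    rw [this, Complex.reCLM_apply, Complex.re_ofReal_mul]
    exact mul_pos (Complex.normSq_pos.2 hδ0) (b.re_mul_deriv_pos h ha0 hmem)
  have hmono := strictMonoOn_of_deriv_pos (convex_Icc (0 : ℝ) 1) hNc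
    (by rw [interior_Icc]; exact hNd)
  have hlt := hmono ⟨le_rfl, zero_le_one⟩ ⟨zero_le_one, le_rfl⟩ one_pos
  simp only [hN, hp0, hp1, heq] at hlt
  exact lt_irrefl _ hlt

end IsArccosBranch

/-! ### Behaviour at infinity, boundary correspondence and the image -/

lemma norm_cos_le_exp (w : ℂ) : ‖Complex.cos w‖ ≤ Real.exp ‖w‖ := by
  have h1 : ‖Complex.exp (w * Complex.I)‖ ≤ Real.exp ‖w‖ := by
    simpa using Complex.norm_exp_le_exp_norm (w * Complex.I)
  have h2 : ‖Complex.exp (-w * Complex.I)‖ ≤ Real.exp ‖w‖ := by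
    simpa using Complex.norm_exp_le_exp_norm (-w * Complex.I)
  rw [Complex.cos, norm_div, Complex.norm_ofNat]
  have := norm_add_le (Complex.exp (w * Complex.I)) (Complex.exp (-w * Complex.I))
  linarith

lemma Equioscillates.tendsto_norm {m : ℕ} {a L : ℝ} {Q : ℝ[X]} {x : ℕ → ℝ}
    (h : Equioscillates m a L Q x) :
    Tendsto (fun z : ℂ => ‖aeval (z ^ 2) Q - z‖) (Bornology.cobounded ℂ) atTop := by
  set F : ℝ[X] := Q.comp (X ^ 2) - X with hF
  have hdeg : 0 < F.degree := by
    by_contra hneg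
    push Not at hneg
    rw [eq_C_of_degree_le_zero hneg] at hF
    have h0 := h.value 0 (by omega)
    have h1 := h.value 1 (by omega)
    have e0 := congrArg (eval (x 0)) hF
    have e1 := congrArg (eval (x 1)) hF
    simp at e0 e1 h0 h1
    linarith [h.error_pos]
  have hdeg' : 0 < (F.map (algebraMap ℝ ℂ)).degree := by rwa [degree_map]
  have := Polynomial.tendsto_norm_atTop (F.map (algebraMap ℝ ℂ)) hdeg'
    (z := fun z : ℂ => z) (l := Bornology.cobounded ℂ) tendsto_norm_cobounded_atTop
  refine this.congr fun z => ?_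
  rw [eval_map_algebraMap, hF, map_sub, aeval_comp_sq, aeval_X]

namespace IsArccosBranch

variable {m : ℕ} {a L B : ℝ} {Q : ℝ[X]} {x : ℕ → ℝ} {φ : ℂ → ℂ}

/-- From `|cos w| ≤ exp |w|`, `|φ|` is at least the logarithm of `|Q(z²) - z| / L`, which tends to
infinity. -/
lemma tendsto_cobounded (b : IsArccosBranch a L Q φ B) (h : Equioscillates m a L Q x) :
    Tendsto φ (Bornology.cobounded ℂ ⊓ 𝓟 closedQuadrant) (Bornology.cobounded ℂ) := by
  rw [← tendsto_norm_atTop_iff_cobounded]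
  have h1 : Tendsto (fun z : ℂ => Real.log (‖aeval (z ^ 2) Q - z‖ / L))
      (Bornology.cobounded ℂ ⊓ 𝓟 closedQuadrant) atTop :=
    Real.tendsto_log_atTop.comp
      ((h.tendsto_norm.mono_left inf_le_left).atTop_div_const h.error_pos)
  have h2 : ∀ᶠ z in Bornology.cobounded ℂ ⊓ 𝓟 closedQuadrant, 1 ≤ ‖aeval (z ^ 2) Q - z‖ :=
    (h.tendsto_norm.mono_left inf_le_left).eventually_ge_atTop 1
  refine tendsto_atTop_mono' _ ?_ h1
  filter_upwards [h2, mem_inf_of_right (mem_principal_self closedQuadrant)] with z hz1 hz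
  have hL := h.error_pos
  rw [Real.log_le_iff_le_exp (div_pos (by linarith) hL), div_le_iff₀ hL, b.cos_eq z hz, norm_mul,
    Complex.norm_real, Real.norm_of_nonneg hL.le, mul_comm]
  exact mul_le_mul_of_nonneg_right (norm_cos_le_exp _) hL.le

lemma isClosed_image (b : IsArccosBranch a L Q φ B) (h : Equioscillates m a L Q x) :
    IsClosed (φ '' closedQuadrant) := by
  have hcont : Continuous (closedQuadrant.domRestrict φ) := b.continuousOn.domRestrict
  have hlim : Tendsto (closedQuadrant.domRestrict φ) (cocompact closedQuadrant) (cocompact ℂ) := by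
    rw [← Metric.cobounded_eq_cocompact (α := ℂ)]
    refine (b.tendsto_cobounded h).comp (tendsto_inf.2 ⟨?_, ?_⟩)
    · rw [Metric.cobounded_eq_cocompact]
      exact isClosed_closedQuadrant.isClosedEmbedding_subtypeVal.tendsto_cocompact
    · exact tendsto_principal.2 (Eventually.of_forall fun z => z.2)
  have hproper : IsProperMap (closedQuadrant.domRestrict φ) :=
    isProperMap_iff_tendsto_cocompact.2 ⟨hcont, hlim⟩
  have := hproper.isClosedMap.isClosed_range
  rwa [Set.range_domRestrict] at this

lemma closure_image (b : IsArccosBranch a L Q φ B) (h : Equioscillates m a L Q x) :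
    closure (φ '' openQuadrant) = φ '' closedQuadrant := by
  refine subset_antisymm (closure_minimal (image_mono openQuadrant_subset) (b.isClosed_image h)) ?_
  have := b.continuousOn
  rw [← closure_openQuadrant] at this ⊢
  exact this.image_closure

lemma isOpen_image (b : IsArccosBranch a L Q φ B) (h : Equioscillates m a L Q x) (ha0 : 0 < a) :
    IsOpen (φ '' openQuadrant) := by
  have han : AnalyticOnNhd ℂ φ openQuadrant := b.differentiableOn.analyticOnNhd isOpen_openQuadrant
  rcases han.is_constant_or_isOpen isPreconnected_openQuadrant with ⟨c, hc⟩ | hopen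
  · have h1 : (1 + Complex.I) ∈ openQuadrant := by simp [openQuadrant]
    have h2 : ((2 : ℝ) : ℂ) * (1 + Complex.I) ∈ openQuadrant := by simp [openQuadrant]
    have h3 := b.re_lt_re_mul h ha0 (c := 2) (by norm_num) h1
    rw [hc _ h1, hc _ h2] at h3
    exact absurd h3 (lt_irrefl _)
  · exact hopen _ subset_rfl isOpen_openQuadrant

lemma map_left (b : IsArccosBranch a L Q φ B) (h : Equioscillates m a L Q x) (ha0 : 0 < a) :
    (fun t : ℝ => φ t) '' Icc 0 a = (fun t : ℝ => (t : ℂ) * Complex.I) '' Icc 0 (φ 0).im := by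
  have hform : ∀ t ∈ Icc 0 a, φ t = ((φ t).im : ℂ) * Complex.I := fun t ht =>
    Complex.ext (by simp [b.re_eq_zero_left h ht.1 ht.2]) (by simp)
  apply subset_antisymm
  · rintro _ ⟨t, ht, rfl⟩
    refine ⟨(φ t).im, ⟨b.im_nonneg (ofReal_mem_closedQuadrant ht.1), ?_⟩, (hform t ht).symm⟩
    have h1 := b.real_re_eq ht.1
    have h2 := b.real_re_eq (le_refl (0 : ℝ))
    have h3 := h.strictAntiOn_left.antitoneOn ⟨le_rfl, ha0.le⟩ ht ht.1
    rw [h1, h2, b.re_eq_zero_left h ht.1 ht.2, b.re_eq_zero_left h le_rfl ha0.le, Real.cos_zero,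
      one_mul, one_mul] at h3
    have h4 := Real.cosh_le_cosh.1 (le_of_mul_le_mul_left h3 h.error_pos)
    rw [abs_of_nonneg (b.im_nonneg (ofReal_mem_closedQuadrant ht.1)),
      abs_of_nonneg (b.im_nonneg (ofReal_mem_closedQuadrant le_rfl))] at h4
    simpa using h4
  · rintro _ ⟨s, hs, rfl⟩
    have hc : ContinuousOn (fun t : ℝ => (φ t).im) (Icc 0 a) :=
      Complex.continuous_im.comp_continuousOn (b.continuousOn_real.mono fun t ht => ht.1)
    obtain ⟨t, ht, hts⟩ := intermediate_value_Icc' ha0.le hc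
      (show s ∈ Icc (φ a).im (φ ((0 : ℝ) : ℂ)).im by
        rw [b.map_a]; simpa using hs)
    refine ⟨t, ht, ?_⟩
    simp only at hts ⊢
    rw [hform t ht, hts]

lemma map_middle (b : IsArccosBranch a L Q φ B) (h : Equioscillates m a L Q x) (ha0 : 0 < a)
    (ha1 : a < 1) :
    (fun t : ℝ => φ t) '' Icc a 1 = (fun t : ℝ => (t : ℂ)) '' Icc 0 ((m + 1) * Real.pi) := by
  have h0 : ∀ t ∈ Icc a 1, 0 ≤ t := fun t ht => ha0.le.trans ht.1
  have hform : ∀ t ∈ Icc a 1, φ t = ((φ t).re : ℂ) := fun t ht =>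
    Complex.ext (by simp) (by
      simp [b.im_eq_zero_of_abs_le h.error_pos (h0 t ht) (h.abs_le t ht)])
  have hmono := b.monotoneOn_real h ha0
  apply subset_antisymm
  · rintro _ ⟨t, ht, rfl⟩
    refine ⟨(φ t).re, ⟨?_, ?_⟩, (hform t ht).symm⟩
    · have := hmono (mem_Ici.2 ha0.le) (mem_Ici.2 (h0 t ht)) ht.1
      simpa [b.map_a] using this
    · have := hmono (mem_Ici.2 (h0 t ht)) (mem_Ici.2 zero_le_one) ht.2
      simp only [b.re_one h ha0] at this
      exact this
  · rintro _ ⟨s, hs, rfl⟩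
    have hc : ContinuousOn (fun t : ℝ => (φ t).re) (Icc a 1) :=
      b.continuousOn_real_re.mono h0
    obtain ⟨t, ht, hts⟩ := intermediate_value_Icc ha1.le hc
      (show s ∈ Icc (φ a).re (φ ((1 : ℝ) : ℂ)).re by
        rw [b.map_a, b.re_one h ha0]; simpa using hs)
    refine ⟨t, ht, ?_⟩
    simp only at hts ⊢
    rw [hform t ht, hts]

lemma map_right (b : IsArccosBranch a L Q φ B) (h : Equioscillates m a L Q x) (ha0 : 0 < a)
    (ha1 : a < 1) :
    (fun t : ℝ => φ t) '' Ici 1 =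
      (fun t : ℝ => (((m + 1) * Real.pi : ℝ) : ℂ) + (t : ℂ) * Complex.I) '' Ici 0 := by
  have hform : ∀ t ∈ Ici (1 : ℝ),
      φ t = (((m + 1) * Real.pi : ℝ) : ℂ) + ((φ t).im : ℂ) * Complex.I := fun t ht => by
    rw [← b.re_eq_right h ha0 ht, Complex.re_add_im]
  have h0 : ∀ t ∈ Ici (1 : ℝ), 0 ≤ t := fun t ht => zero_le_one.trans ht
  apply subset_antisymm
  · rintro _ ⟨t, ht, rfl⟩
    exact ⟨(φ t).im, b.im_nonneg (ofReal_mem_closedQuadrant (h0 t ht)), (hform t ht).symm⟩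
  · rintro _ ⟨s, hs, rfl⟩
    have hlim : Tendsto (fun t : ℝ => ‖φ t‖) atTop atTop := by
      have h1 := (tendsto_norm_atTop_iff_cobounded).2 (b.tendsto_cobounded h)
      refine h1.comp (f := fun t : ℝ => (t : ℂ)) (tendsto_inf.2 ⟨?_, tendsto_principal.2 ?_⟩)
      · rw [← tendsto_norm_atTop_iff_cobounded]
        simpa using tendsto_abs_atTop_atTop
      · filter_upwards [eventually_ge_atTop 0] with t ht using ofReal_mem_closedQuadrant ht
    obtain ⟨T, hT, hT1⟩ := ((hlim.eventually_ge_atTop (s + (m + 1) * Real.pi)).and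
      (eventually_ge_atTop 1)).exists
    have hW : 0 < (m + 1) * Real.pi := by positivity
    have hsT : s ≤ (φ T).im := by
      have h1 := Complex.norm_le_abs_re_add_abs_im (φ T)
      rw [b.re_eq_right h ha0 hT1, abs_of_pos hW,
        abs_of_nonneg (b.im_nonneg (ofReal_mem_closedQuadrant (h0 T hT1)))] at h1
      linarith
    have hc : ContinuousOn (fun t : ℝ => (φ t).im) (Icc 1 T) :=
      Complex.continuous_im.comp_continuousOn (b.continuousOn_real.mono fun t ht => h0 t ht.1)
    obtain ⟨t, ht, hts⟩ := intermediate_value_Icc hT1 hc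
      (show s ∈ Icc (φ ((1 : ℝ) : ℂ)).im (φ T).im by
        rw [b.im_eq_zero_of_abs_le h.error_pos zero_le_one (h.abs_le 1 ⟨ha1.le, le_rfl⟩)]
        exact ⟨hs, hsT⟩)
    refine ⟨t, ht.1, ?_⟩
    simp only at hts ⊢
    rw [hform t ht.1, hts]

/-- The functional equation does most of the work: it recovers `y` from the point of the curve,
giving simplicity, and `y ≤ L sinh v ≤ L exp v` sends `v` to infinity. -/
lemma isCrosscut (b : IsArccosBranch a L Q φ B) (h : Equioscillates m a L Q x) (ha0 : 0 < a) :
    IsCrosscut ((m + 1) * Real.pi) (fun y : ℝ => φ (y * Complex.I)) (φ 0).im where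
  continuousOn := b.continuousOn_imag.mono Ioi_subset_Ici_self
  injOn := by
    intro y₁ h1 y₂ h2 heq
    have e1 := b.imag_im_eq (le_of_lt h1)
    have e2 := b.imag_im_eq (le_of_lt h2)
    simp only at heq
    rw [heq] at e1
    exact e1.symm.trans e2
  mapsTo := by
    intro y hy
    have hu := b.imag_re_mem h ha0 hy
    refine ⟨hu.1, hu.2.trans_le ?_, (b.imag_im_pos h.error_pos hy).1⟩
    nlinarith [Real.pi_pos, (Nat.cast_nonneg m : (0 : ℝ) ≤ m)]
  start_pos := b.map_zero_im_pos h ha0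
  tendsto_start := by
    have h1 := (b.continuousOn_imag 0 (mem_Ici.2 le_rfl)).tendsto.mono_left
      (nhdsWithin_mono _ Ioi_subset_Ici_self)
    have h2 : φ (((0 : ℝ) : ℂ) * Complex.I) = ((φ 0).im : ℂ) * Complex.I := by
      rw [Complex.ofReal_zero, zero_mul]
      exact Complex.ext (by simp [b.map_zero_re h ha0]) (by simp)
    rwa [h2] at h1
  tendsto_end := by
    have hL := h.error_pos
    have h1 : Tendsto (fun y : ℝ => Real.log (y / L)) atTop atTop :=
      Real.tendsto_log_atTop.comp (tendsto_id.atTop_div_const hL)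
    refine tendsto_atTop_mono' _ ?_ h1
    filter_upwards [eventually_gt_atTop 0] with y hy
    rw [Real.log_le_iff_le_exp (div_pos hy hL), div_le_iff₀ hL]
    have e := b.imag_im_eq hy.le
    have hv := (b.imag_im_pos hL hy).1
    set u := (φ (y * Complex.I)).re
    set v := (φ (y * Complex.I)).im
    have hs := Real.sinh_pos_iff.2 hv
    have h2 : Real.sin u * Real.sinh v ≤ Real.sinh v :=
      mul_le_of_le_one_left hs.le (Real.sin_le_one u)
    have h3 : Real.sinh v ≤ Real.exp v := by
      rw [Real.sinh_eq]; linarith [Real.exp_pos v, Real.exp_pos (-v)]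
    calc y = L * (Real.sin u * Real.sinh v) := e.symm
      _ ≤ L * Real.exp v := mul_le_mul_of_nonneg_left (h2.trans h3) hL.le
      _ = Real.exp v * L := mul_comm _ _

/-- The image is open and its closure is the image of the closed quadrant, so the frontier consists
of boundary values that are not interior values. Points of the three sides are not interior values
because the image lies in the open half-strip; points of the curve are not, by `eq_of_map_eq`. -/
lemma frontier_image (b : IsArccosBranch a L Q φ B) (h : Equioscillates m a L Q x) (ha0 : 0 < a)
    (ha1 : a < 1) : frontier (φ '' openQuadrant) =
      (fun y : ℝ => φ (y * Complex.I)) '' Ioi 0 ∪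
        (fun t : ℝ => (t : ℂ) * Complex.I) '' Icc 0 (φ 0).im
      ∪ (fun t : ℝ => (t : ℂ)) '' Icc 0 ((m + 1) * Real.pi)
      ∪ (fun t : ℝ => (((m + 1) * Real.pi : ℝ) : ℂ) + (t : ℂ) * Complex.I) '' Ici 0 := by
  have hout : ∀ w, w ∈ φ '' openQuadrant → w ∈ halfStrip ((m + 1) * Real.pi) := by
    rintro _ ⟨z, hz, rfl⟩
    exact b.mapsTo_halfStrip h ha0 hz
  rw [frontier, (b.isOpen_image h ha0).interior_eq, b.closure_image h]
  apply subset_antisymm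
  · rintro _ ⟨⟨z, hz, rfl⟩, hnot⟩
    have hzQ : z ∉ openQuadrant := fun hzQ => hnot (mem_image_of_mem φ hzQ)
    have hreal : ∀ t : ℝ, 0 ≤ t → φ t ∈ (fun y : ℝ => φ (y * Complex.I)) '' Ioi 0 ∪
        (fun t : ℝ => (t : ℂ) * Complex.I) '' Icc 0 (φ 0).im
      ∪ (fun t : ℝ => (t : ℂ)) '' Icc 0 ((m + 1) * Real.pi)
      ∪ (fun t : ℝ => (((m + 1) * Real.pi : ℝ) : ℂ) + (t : ℂ) * Complex.I) '' Ici 0 := by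
      intro t ht
      rw [← b.map_left h ha0, ← b.map_middle h ha0 ha1, ← b.map_right h ha0 ha1]
      rcases le_total t a with h1 | h1
      · exact Or.inl (Or.inl (Or.inr ⟨t, ⟨ht, h1⟩, rfl⟩))
      rcases le_total t 1 with h2 | h2
      · exact Or.inl (Or.inr ⟨t, ⟨h1, h2⟩, rfl⟩)
      · exact Or.inr ⟨t, h2, rfl⟩
    rcases hz.2.eq_or_lt with h0 | h0
    · have hzt : z = ((z.re : ℝ) : ℂ) := Complex.ext (by simp) (by simp [← h0])
      rw [hzt]
      exact hreal _ hz.1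
    · have hre : z.re = 0 := by
        by_contra hne
        exact hzQ ⟨lt_of_le_of_ne hz.1 (Ne.symm hne), h0⟩
      refine Or.inl (Or.inl (Or.inl ⟨z.im, h0, ?_⟩))
      simp only
      congr 1
      exact Complex.ext (by simp [hre]) (by simp)
  · have hmem : ∀ {s : Set ℝ}, (∀ t ∈ s, 0 ≤ t) →
        (fun t : ℝ => φ t) '' s ⊆ φ '' closedQuadrant := by
      rintro s hs _ ⟨t, ht, rfl⟩
      exact ⟨t, ofReal_mem_closedQuadrant (hs t ht), rfl⟩
    rintro w (((hw | hw) | hw) | hw)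
    · obtain ⟨y, hy, rfl⟩ := hw
      have hyc : (y : ℂ) * Complex.I ∈ closedQuadrant :=
        ofReal_mul_I_mem_closedQuadrant (le_of_lt hy)
      refine ⟨⟨_, hyc, rfl⟩, ?_⟩
      rintro ⟨z, hz, hzw⟩
      have hy0 : (y : ℂ) * Complex.I ≠ 0 := by
        simpa using (ne_of_gt (mem_Ioi.1 hy))
      have := b.eq_of_map_eq h ha0 hz hyc hy0 hzw
      rw [this] at hz
      simp [openQuadrant] at hz
    · refine ⟨?_, fun hG => ?_⟩
      · rw [← b.map_left h ha0] at hw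
        exact hmem (fun t ht => ht.1) hw
      · obtain ⟨s, -, rfl⟩ := hw
        have := (hout _ hG).1
        simp at this
    · refine ⟨?_, fun hG => ?_⟩
      · rw [← b.map_middle h ha0 ha1] at hw
        exact hmem (fun t ht => ha0.le.trans ht.1) hw
      · obtain ⟨s, -, rfl⟩ := hw
        have := (hout _ hG).2.2
        simp at this
    · refine ⟨?_, fun hG => ?_⟩
      · rw [← b.map_right h ha0 ha1] at hw
        exact hmem (fun t ht => zero_le_one.trans ht) hw
      · obtain ⟨s, -, rfl⟩ := hw
        have := (hout _ hG).2.1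
        simp at this

lemma isRegionBoundedOnLeft (b : IsArccosBranch a L Q φ B) (h : Equioscillates m a L Q x)
    (ha0 : 0 < a) (ha1 : a < 1) :
    IsRegionBoundedOnLeft ((m + 1) * Real.pi) (fun y : ℝ => φ (y * Complex.I)) (φ 0).im
      (φ '' openQuadrant) where
  frontier_eq := b.frontier_image h ha0 ha1
  component := by
    set γ : ℝ → ℂ := fun y : ℝ => φ (y * Complex.I) with hγ
    have hfr := b.frontier_image h ha0 ha1
    have hopen := b.isOpen_image h ha0
    have hsub : φ '' openQuadrant ⊆ halfStrip ((m + 1) * Real.pi) \ γ '' Ioi 0 := by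
      intro w hw
      refine ⟨?_, fun hwγ => ?_⟩
      · obtain ⟨z, hz, rfl⟩ := hw
        exact b.mapsTo_halfStrip h ha0 hz
      · have hwf : w ∈ frontier (φ '' openQuadrant) := by
          rw [hfr]; exact Or.inl (Or.inl (Or.inl hwγ))
        rw [hopen.frontier_eq] at hwf
        exact hwf.2 hw
    have h1 : (1 + Complex.I) ∈ openQuadrant := by simp [openQuadrant]
    have hw := mem_image_of_mem φ h1
    refine ⟨φ (1 + Complex.I), hsub hw, subset_antisymm ?_ ?_⟩
    · exact (isPreconnected_openQuadrant.image φ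
        (b.continuousOn.mono openQuadrant_subset)).subset_connectedComponentIn hw hsub
    -- The frontier of the image misses the cut half-strip, so the image is relatively closed as
    -- well as open there and fills its component.
    · refine isPreconnected_connectedComponentIn.subset_of_closure_inter_subset hopen
        ⟨_, mem_connectedComponentIn (hsub hw), hw⟩ ?_
      rintro w ⟨hwc, hwC⟩
      by_contra hwn
      have hwS := connectedComponentIn_subset _ _ hwC
      have hwf : w ∈ frontier (φ '' openQuadrant) := by
        rw [hopen.frontier_eq]; exact ⟨hwc, hwn⟩
      rw [hfr] at hwf
      rcases hwf with ((hwf | hwf) | hwf) | hwf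
      · exact hwS.2 hwf
      · obtain ⟨s, -, rfl⟩ := hwf
        have := hwS.1.1
        simp at this
      · obtain ⟨s, -, rfl⟩ := hwf
        have := hwS.1.2.2
        simp at this
      · obtain ⟨s, -, rfl⟩ := hwf
        have := hwS.1.2.1
        simp at this

lemma isNormalizedConformalMap (b : IsArccosBranch a L Q φ B) (h : Equioscillates m a L Q x)
    (ha0 : 0 < a) (ha1 : a < 1) :
    IsNormalizedConformalMap a ((m + 1) * Real.pi) φ (φ '' openQuadrant) where
  differentiableOn := b.differentiableOn
  injOn := fun z₁ h1 z₂ h2 heq => b.eq_of_map_eq h ha0 h1 (openQuadrant_subset h2)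
    (fun h0 => by rw [h0] at h2; exact lt_irrefl _ h2.1) heq
  image_eq := rfl
  continuousOn := b.continuousOn
  map_a := b.map_a
  map_one := by
    have h1 := b.re_one h ha0
    have h2 := b.im_eq_zero_of_abs_le h.error_pos zero_le_one (h.abs_le 1 ⟨ha1.le, le_rfl⟩)
    rw [Complex.ofReal_one] at h1 h2
    exact Complex.ext (by rw [h1, Complex.ofReal_re]) (by rw [h2, Complex.ofReal_im])
  map_infty := b.tendsto_cobounded h

end IsArccosBranch

theorem mainTheorem5 (m : ℕ) (hm : 1 ≤ m) (a : ℝ) (ha0 : 0 < a) (ha1 : a < 1) :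
    (∃! P : ℝ[X], IsBestApprox m a P) ∧
    ∀ P : ℝ[X], IsBestApprox m a P →
      ∃ (γ : ℝ → ℂ) (v₀ : ℝ) (G : Set ℂ) (φ : ℂ → ℂ),
        IsCrosscut (((m : ℝ) + 1) * Real.pi) γ v₀ ∧
        IsRegionBoundedOnLeft (((m : ℝ) + 1) * Real.pi) γ v₀ G ∧
        IsNormalizedConformalMap a (((m : ℝ) + 1) * Real.pi) φ G ∧
        (∀ z ∈ closedQuadrant,
          aeval z P = z + (approxError m a : ℂ) * Complex.cos (φ z)) ∧
        (∀ y : ℝ, 0 < y → φ ((y : ℂ) * Complex.I) = γ y) ∧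
        (∀ y : ℝ, 0 < y →
          approxError m a * Real.sin (γ y).re * Real.sinh (γ y).im = y) := by
  obtain ⟨L, Q, x, h⟩ := exists_equioscillates hm ha0 ha1
  obtain ⟨herr, hbest⟩ := h.isBestApprox_iff ha0 ha1
  refine ⟨⟨Q.comp (X ^ 2), (hbest _).2 rfl, fun P hP => (hbest P).1 hP⟩, fun P hP => ?_⟩
  obtain rfl := (hbest P).1 hP
  obtain ⟨φ, B, b⟩ := h.exists_isArccosBranch ha0 ha1
  refine ⟨fun y => φ (y * Complex.I), (φ 0).im, φ '' openQuadrant, φ, b.isCrosscut h ha0,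
    b.isRegionBoundedOnLeft h ha0 ha1, b.isNormalizedConformalMap h ha0 ha1, fun z hz => ?_,
    fun y _ => rfl, fun y hy => ?_⟩
  · rw [herr, aeval_comp_sq, ← b.cos_eq z hz]
    ring
  · rw [herr, mul_assoc]
    exact b.imag_im_eq hy.le
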